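/- **Setting.** Let $f:\mathbb R^d\times\mathcal Z\to\mathbb R$, let $\mathcal D$ be a probability distribution on $\mathcal Z$, and $F(x)=\mathbb E_{z\sim\mathcal D}[f(x,z)]$. Let $\mathcal X\subseteq\mathbb R^d$ be convex and compact with diameter $R$. Assume: $F$ is differentiable and $\mu$-strongly convex on $\mathcal X$, i.e. $\langle\nabla F(x)-\nabla F(y),x-y\rangle\ge\mu\|x-y\|^2$ for $x,y\in\mathcal X$; every $f(\cdot,z)$ is differentiable with $\|\nabla f(x,z)-\nabla f(y,z)\|\le L\|x-y\|$ on $\mathcal X$; for all $x\in\mathcal X$ and $k\le d$ the variable $f_k=\partial_kf(x,z)-\partial_kF(x)$ is sub-gamma, $\log\mathbb E[e^{\lambda f_k}]\le\frac{\lambda^2\sigma^2}{2(1-a|\lambda|)}$ for $a|\lambda|<1$ (with $\sigma,a\ge 0$); $F$ has a unique minimizer $x^\star$ over $\mathcal X$, and $\nabla F(x^\star)=0$. Put $\kappa=L/\mu$. There are $N$ agents. At each iteration $t=1,2,\dots$ an agent is either trustworthy or Byzantine; the agents' states move as independent two-state Markov chains with probabilities $p_b$ (trustworthy to Byzantine)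 and $p_t$ (Byzantine to trustworthy), $0<p_b<p_t<1$, from an arbitrary initial distribution. At each iteration every agent draws $b$ fresh independent samples from $\mathcal D$, independent of the past and of the current states (SA setting). At iteration $t$ a trustworthy agent $i$ sends the minibatch gradient $g_{i,t}=\frac1b\sum_{j\le b}\nabla f(x_t,z_{i,t}^j)$ at the current iterate; a Byzantine agent sends an arbitrary vector, which may depend on everything that has happened so far, but not on the future. For $0\le\alpha<1/2$ with $\alpha k\in\mathbb N_0$, the robust mean with threshold $\alpha$ of $k$ vectors is, in each coordinate, the average of the $(1-\alpha)k$ entries nearest to their median (ties broken arbitrarily). The algorithm RANGE with window $m\ge1$, thresholds $\alpha_1,\alpha_2\in[0,1/2)$ such that $\alpha_1m,\alpha_2N\in\mathbb N_0$, and step size $\gamma>0$ starts from $x_1\in\mathcal X$; at iteration $t$ it lets $\hat g_{i,t}=g_{i,t}$ if $t<m$ and otherwise lets $\hat g_{i,t}$ be the robust mean of $g_{i,t-m+1},\dots,g_{i,t}$ with threshold $\alpha_1$, lets $\hat{\hat g}_t$ be the robust mean of $\hat g_{1,t},\dots,\hat g_{N,t}$ with threshold $\alpha_2$, and sets $x_{t+1}=\Pi_{\mathcal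 X}(x_t-\gamma\hat{\hat g}_t/\|\hat{\hat g}_t\|)$ (with $0/0=0$). For $m_0\in\mathbb N_0$ let $P_Z^m(m_0)$ be any upper bound, uniform over the states of the agents at time $t-m+1-m_0$ (conditioned upon), on the probability that more than $\alpha_2N$ agents are Byzantine more than $\alpha_1m$ times in the window $t-m+1,\dots,t$; for example the maximum of this probability. Put $$C_\alpha=\frac{2\alpha}{1-\alpha}\Big(1+\sqrt{\tfrac{(1-\alpha)^2}{1-2\alpha}}\Big)\sqrt d,\qquad c_0=\frac{2}{\kappa R}\big(1-P_Z^m(m_0)(1+\kappa)\big),$$ $$\overline C=1+4P_Z^m(m_0)(1+1/\kappa)(m-1+m_0)+4\kappa(m-1)\big(1+C_{\alpha_1}+2C_{\alpha_2}(C_{\alpha_1}+1)\big).$$ **Theorem.** Suppose that $P_Z^m(m_0)<\frac1{1+\kappa}$, that $\gamma\le\frac{4\sigma}{\overline C\mu\sqrt{(1-\alpha_2)N(1-\alpha_1)mb}}$ and that $c_0\gamma\le1$. Then for every $T\ge1$ $$\mathbb E\|x_{T+m+m_0}-x^\star\|^2\le\big(\|x_1-x^\star\|+\gamma(m+m_0-1)\big)^2(1-c_0\gamma)^T+\mathcal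 E,$$ where $$\mathcal E=\frac{K}{\mu c_0}\left[\frac{\sigma\sqrt d}{\sqrt{(1-\alpha_1)mNb}}+\big(C_{\alpha_2}+C_{\alpha_1}(1+C_{\alpha_2})\big)\Big(\frac{\sigma\sqrt{\log(4Nmd)}}{\sqrt b}+\frac{a\log(4Nmd)}{b}\Big)\right]$$ and $K$ is an absolute constant. In particular, up to logarithmic factors and factors depending on $\sigma,a,\mu,d,c_0$ only, $\mathcal E=\mathcal O\Big(\frac1{\sqrt{(1-\alpha_1)mNb}}+\frac{C_{\alpha_2}+C_{\alpha_1}(1+C_{\alpha_2})}{\sqrt b}\Big)$. -/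

import Mathlib

open MeasureTheory ProbabilityTheory
open scoped BigOperators

noncomputable section

namespace RANGE

/-- The parameter space `ℝ^d` with its Euclidean norm. -/
abbrev Vec (d : ℕ) := EuclideanSpace ℝ (Fin d)

/-! ### Cost functions -/

/-- `h` is differentiable and its gradient is `L`-Lipschitz on `X`. -/
def IsSmoothOn {d : ℕ} (X : Set (Vec d)) (L : ℝ) (h : Vec d → ℝ) : Prop :=
  Differentiable ℝ h ∧
    ∀ x ∈ X, ∀ y ∈ X, ‖gradient h x - gradient h y‖ ≤ L * ‖x - y‖

/-- `h` is differentiable and its gradient is `μ`-strongly monotone on `X`. -/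
def IsStronglyConvexOn {d : ℕ} (X : Set (Vec d)) (μ : ℝ) (h : Vec d → ℝ) : Prop :=
  Differentiable ℝ h ∧
    ∀ x ∈ X, ∀ y ∈ X,
      μ * ‖x - y‖ ^ 2 ≤ inner ℝ (gradient h x - gradient h y) (x - y)

/-- The population risk `F(x) = 𝔼_{z ∼ D} f(x, z)`. -/
def risk {d : ℕ} {Z : Type*} [MeasurableSpace Z] (D : Measure Z) (f : Vec d → Z → ℝ)
    (x : Vec d) : ℝ := ∫ z, f x z ∂D

/-- The empirical risk `(1/b) ∑_j f(x, z_j)` of a minibatch. -/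
def empiricalRisk {d b : ℕ} {Z : Type*} (f : Vec d → Z → ℝ) (z : Fin b → Z)
    (x : Vec d) : ℝ := (1 / (b : ℝ)) * ∑ j, f x (z j)

/-- `Y` is sub-gamma under `D` with variance factor `σ` and scale parameter `a`.
The range `|l| < 1 / a` is written `a * |l| < 1`, so that it is all of `ℝ` when `a = 0`. -/
def IsSubGamma {Z : Type*} [MeasurableSpace Z] (D : Measure Z) (Y : Z → ℝ) (σ a : ℝ) : Prop :=
  ∀ l : ℝ, a * |l| < 1 →
    Integrable (fun z => Real.exp (l * Y z)) D ∧
    Real.log (∫ z, Real.exp (l * Y z) ∂D) ≤ l ^ 2 * σ ^ 2 / (2 * (1 - a * |l|))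

/-! ### The robust mean estimator -/

/-- `c` is a median of the finite family `u`: at least half of the entries are `≤ c` and at
least half are `≥ c`. (For an even number of entries this allows every point between the two
middle entries, in particular their average.) -/
def IsMedian {k : ℕ} (u : Fin k → ℝ) (c : ℝ) : Prop :=
  k ≤ 2 * (Finset.univ.filter (fun i => u i ≤ c)).card ∧
  k ≤ 2 * (Finset.univ.filter (fun i => c ≤ u i)).card

/-- `w` is a robust mean of the vectors `v_0, …, v_{k-1}` with threshold `α`: each coordinate of
`w` is the average of the `(1 - α) k` entries nearest to a median of that coordinate, ties being
broken arbitrarily. -/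
def IsRobustMean {d k : ℕ} (α : ℝ) (v : Fin k → Vec d) (w : Vec d) : Prop :=
  ∀ j : Fin d, ∃ c : ℝ, IsMedian (fun i => v i j) c ∧
    ∃ s : Finset (Fin k), (s.card : ℝ) = (1 - α) * k ∧
      (∀ i ∈ s, ∀ l ∉ s, |v i j - c| ≤ |v l j - c|) ∧
      w j = (1 / ((1 - α) * k)) * ∑ i ∈ s, v i j

/-- `p` is a Euclidean projection of `u` onto `X`. -/
def IsProjection {d : ℕ} (X : Set (Vec d)) (u p : Vec d) : Prop :=
  p ∈ X ∧ ∀ y ∈ X, ‖u - p‖ ≤ ‖u - y‖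

/-! ### The Markov chain of an agent; `false` is trustworthy, `true` is Byzantine -/

/-- One-step transition matrix of an agent. -/
def transition (pb pt : ℝ) : Matrix Bool Bool ℝ
  | false, false => 1 - pb
  | false, true => pb
  | true, false => pt
  | true, true => 1 - pt

/-- The probability that, for a chain whose current state is `s`, the number of Byzantine states
among the current and the next `n - 1` states, added to `c`, exceeds `θ`. -/
def windowTail (pb pt θ : ℝ) : ℕ → ℕ → Bool → ℝ
  | 0, c, _ => if θ < (c : ℝ) then 1 else 0
  | n + 1, c, s => ∑ s', transition pb pt s s' * windowTail pb pt θ n (c + s.toNat) s'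

/-- The probability that, for a chain whose current state is `s`, more than `α₁ m` of the `m`
states starting `m₀` steps from now are Byzantine. -/
def agentFailure (pb pt α₁ : ℝ) (m m₀ : ℕ) (s : Bool) : ℝ :=
  ∑ s', (transition pb pt ^ m₀) s s' * windowTail pb pt (α₁ * m) m 0 s'

/-- The probability that, for `N` independent chains whose current states are `w`, more than
`α₂ N` of them have more than `α₁ m` Byzantine states in the window of `m` states that starts
`m₀` steps from now. -/
def networkFailure (pb pt α₁ α₂ : ℝ) (N m m₀ : ℕ) (w : Fin N → Bool) : ℝ :=
  ∑ S ∈ (Finset.univ : Finset (Finset (Fin N))).filter (fun S => α₂ * N < (S.card : ℝ)),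
    (∏ i ∈ S, agentFailure pb pt α₁ m m₀ (w i)) *
      ∏ i ∈ Sᶜ, (1 - agentFailure pb pt α₁ m m₀ (w i))

/-- The least bound, uniform in the current network state, on the failure probability
`networkFailure`. -/
def worstFailure (pb pt α₁ α₂ : ℝ) (N m m₀ : ℕ) : ℝ :=
  ⨆ w : Fin N → Bool, networkFailure pb pt α₁ α₂ N m m₀ w

/-! ### Stochastic environment and algorithm -/

/-- Randomness up to iteration `H`. `ℱ t` is the information available after iteration `t`
(states and samples of iterations `1, …, t`, and any further randomness, for instance of the
adversary). The agents' states move as independent copies of the two-state chain, from an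
arbitrary initial distribution; at every iteration each agent gets `b` fresh independent samples
from `D`, independent of the past and of the current states. -/
structure IsEnvironment {Ω Z : Type*} [mΩ : MeasurableSpace Ω] [MeasurableSpace Z]
    (P : Measure Ω) (ℱ : Filtration ℕ mΩ) (D : Measure Z) (pb pt : ℝ) (H : ℕ) {N b : ℕ}
    (W : ℕ → Fin N → Ω → Bool) (z : ℕ → Fin N → Fin b → Ω → Z) : Prop where
  state_adapted : ∀ t, 1 ≤ t → t ≤ H → ∀ i, Measurable[ℱ t] (W t i)
  sample_adapted : ∀ t, 1 ≤ t → t ≤ H → ∀ i j, Measurable[ℱ t] (z t i j)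
  markov : ∀ t, 1 ≤ t → t < H → ∀ w : Fin N → Bool,
    P[Set.indicator {ω | ∀ i, W (t + 1) i ω = w i} (fun _ => (1 : ℝ)) | ℱ t]
      =ᵐ[P] fun ω => ∏ i, transition pb pt (W t i ω) (w i)
  sample_law : ∀ t, 1 ≤ t → t ≤ H →
    P.map (fun ω (i : Fin N) (j : Fin b) => z t i j ω)
      = Measure.pi (fun _ => Measure.pi (fun _ => D))
  sample_fresh : ∀ t, t < H →
    Indep (MeasurableSpace.comap (fun ω (i : Fin N) (j : Fin b) => z (t + 1) i j ω) inferInstance)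
      (ℱ t ⊔ MeasurableSpace.comap (fun ω (i : Fin N) => W (t + 1) i ω) inferInstance) P

/-- `x` is the sequence of iterates of a run of the algorithm over iterations `1, …, H`, with
received feedback `g`, robustified gradients `gh` and aggregates `gg`. The feedback of a Byzantine
agent is arbitrary, subject only to not anticipating the future; ties in the estimators are
likewise broken without anticipation. The inverse of a zero norm is `0`. -/
structure IsRun {Ω Z : Type*} [mΩ : MeasurableSpace Ω] (ℱ : Filtration ℕ mΩ) {d N b : ℕ}
    (f : Vec d → Z → ℝ) (X : Set (Vec d)) (x₁ : Vec d) (γ α₁ α₂ : ℝ) (m H : ℕ)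
    (W : ℕ → Fin N → Ω → Bool) (z : ℕ → Fin N → Fin b → Ω → Z)
    (g gh : ℕ → Fin N → Ω → Vec d) (gg x : ℕ → Ω → Vec d) : Prop where
  init : ∀ ω, x 1 ω = x₁
  trustworthy : ∀ t, 1 ≤ t → t ≤ H → ∀ i ω, W t i ω = false →
    g t i ω = gradient (empiricalRisk f (fun j => z t i j ω)) (x t ω)
  feedback_adapted : ∀ t, 1 ≤ t → t ≤ H → ∀ i, Measurable[ℱ t] (g t i)
  iterate_adapted : ∀ t, 1 ≤ t → t ≤ H → Measurable[ℱ t] (x (t + 1))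
  early : ∀ t, 1 ≤ t → t ≤ H → t < m → ∀ i ω, gh t i ω = g t i ω
  temporal : ∀ t, 1 ≤ t → t ≤ H → m ≤ t → ∀ i ω,
    IsRobustMean α₁ (fun τ : Fin m => g (t - (τ : ℕ)) i ω) (gh t i ω)
  aggregate : ∀ t, 1 ≤ t → t ≤ H → ∀ ω, IsRobustMean α₂ (fun i => gh t i ω) (gg t ω)
  update : ∀ t, 1 ≤ t → t ≤ H → ∀ ω,
    IsProjection X (x t ω - γ • (‖gg t ω‖⁻¹ • gg t ω)) (x (t + 1) ω)

/-! ### The constants of the bound -/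

/-- `C_α`. -/
def Calpha (d : ℕ) (α : ℝ) : ℝ :=
  2 * α / (1 - α) * (1 + √((1 - α) ^ 2 / (1 - 2 * α))) * √(d : ℝ)

/-- `c₀`, with `p` the uniform failure probability bound. -/
def czero (κ R p : ℝ) : ℝ := 2 / (κ * R) * (1 - p * (1 + κ))

/-- `C̄`, with `p` the uniform failure probability bound. -/
def Cbar (d : ℕ) (κ p α₁ α₂ : ℝ) (m m₀ : ℕ) : ℝ :=
  1 + 4 * p * (1 + 1 / κ) * ((m : ℝ) - 1 + m₀)
    + 4 * κ * ((m : ℝ) - 1)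
      * (1 + Calpha d α₁ + 2 * Calpha d α₂ * (Calpha d α₁ + 1))

end RANGE

end

noncomputable section

namespace RANGE

/-! ### The robust mean -/

/-! Write $\delta_t=\|x_t-x^\star\|$, $v_t$ for the aggregate and $e_t=\|v_t-\nabla F(x_t)\|$. The
proof derives a contraction $\mathbb E\delta_{t+1}^2\le(1-c_0\gamma)\mathbb
E\delta_t^2+\text{error}$ and iterates it.

Geometry: strong convexity and smoothness give $\langle
v_t/\|v_t\|,x_t-x^\star\rangle\ge\delta_t/\kappa-2e_t/\mu$ (`inner_normalized_ge`), while the left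
side is never below $-\delta_t$. The first bound is used when at most $\alpha_2N$ agents are
Byzantine more than $\alpha_1m$ times in the window, the second on the complementary failure event.

Accuracy of the aggregate: every agent draws samples, also a Byzantine one, so each agent and time
has a reference value, the honest minibatch gradient. On the good event the nested robust means
differ from the plain mean of all references by a multiple of their largest deviation from $\nabla
F(x_t)$ (`IsRobustMean.abs_nested_sub_mean_le`). That deviation is gradient drift, at most
$L\gamma(m-1)$, plus the maximal noise, which costs a logarithm (`exists_maxNoise_envelope`). The
plain mean of the noise is free of any selection made by the adversary; it is a martingale sum, of
order $\sigma\sqrt{d/(mNb)}$ (`exists_meanNoise_envelope`).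

Failure: $\delta_t$ and the failure event are dependent. As a step has length at most $\gamma$,
$\delta_t$ may be exchanged for the distance $m-1+m_0$ steps earlier. Conditioning on the states at
that time bounds the failure probability by $p$ (`IsEnvironment.integral_mul_failure_le`).

Finally $\delta_t^2\le R\,\delta_t$ turns the linear decrease into the contraction, and the
step-size condition turns the terms of order $\gamma^2$ into statistical error (`step_error_le`). -/

theorem IsMedian.abs_sub_le {k : ℕ} {u v : Fin k → ℝ} {c r Δ : ℝ} (hc : IsMedian u c)
    {bad : Finset (Fin k)} (hbad : 2 * bad.card < k) (hv : ∀ i ∉ bad, u i = v i)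
    (h : ∀ i, |v i - r| ≤ Δ) : |c - r| ≤ Δ := by
  -- Corrupted entries are a strict minority, so each half of the data cut off by the median
  -- contains an honest entry; these two entries enclose `c`.
  have key : ∀ s : Finset (Fin k), k ≤ 2 * s.card → ∃ i ∈ s, i ∉ bad := by
    intro s hs
    by_contra! hcon
    have := Finset.card_le_card (show s ⊆ bad from hcon)
    omega
  obtain ⟨i, hi, hib⟩ := key _ hc.1
  obtain ⟨l, hl, hlb⟩ := key _ hc.2
  have hi' := (Finset.mem_filter.1 hi).2
  have hl' := (Finset.mem_filter.1 hl).2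
  rw [hv i hib] at hi'
  rw [hv l hlb] at hl'
  have h1 := abs_le.1 (h i)
  have h2 := abs_le.1 (h l)
  exact abs_le.2 ⟨by linarith, by linarith⟩

/-- A trimmed mean around a median is close to the mean of any family which agrees with the data
off a small set of indices. -/
theorem IsMedian.abs_trimmedMean_sub_mean_le {k : ℕ} (hk : 1 ≤ k) {α : ℝ} (hα : 0 ≤ α)
    (hα' : α < 1 / 2) {u v : Fin k → ℝ} {c r Δ : ℝ} (hc : IsMedian u c)
    {bad : Finset (Fin k)} (hbad : (bad.card : ℝ) ≤ α * k) (hv : ∀ i ∉ bad, u i = v i)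
    (h : ∀ i, |v i - r| ≤ Δ) {s : Finset (Fin k)} (hs : (s.card : ℝ) = (1 - α) * k)
    (hnear : ∀ i ∈ s, ∀ l ∉ s, |u i - c| ≤ |u l - c|) :
    |(1 / ((1 - α) * k)) * ∑ i ∈ s, u i - (1 / (k : ℝ)) * ∑ i, v i|
      ≤ 6 * α / (1 - α) * Δ := by
  have hk0 : (0 : ℝ) < k := by exact_mod_cast hk
  have hΔ : 0 ≤ Δ := (abs_nonneg _).trans (h ⟨0, hk⟩)
  have hbad2 : 2 * bad.card < k := by
    have : (2 : ℝ) * bad.card < k := by nlinarith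
    exact_mod_cast this
  have hcr := hc.abs_sub_le hbad2 hv h
  have hgood : ∀ i ∉ bad, |u i - c| ≤ 2 * Δ := by
    intro i hi
    rw [hv i hi]
    have h1 := abs_le.1 (h i)
    have h2 := abs_le.1 hcr
    exact abs_le.2 ⟨by linarith, by linarith⟩
  have hcompl : (sᶜ.card : ℝ) = α * k := by
    rw [Finset.card_compl, Fintype.card_fin, Nat.cast_sub (by simpa using s.card_le_univ), hs]
    ring
  -- A selected entry farther than $2\Delta$ from the median would be corrupted, and so would all
  -- $\alpha k$ discarded entries, which are at least as far: one corruption too many.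
  have hsel : ∀ i ∈ s, |u i - r| ≤ 3 * Δ := by
    intro i hi
    have h1 : |u i - c| ≤ 2 * Δ := by
      by_contra! hcon
      have hsub : insert i sᶜ ⊆ bad := by
        intro l hl
        by_contra hlb
        rcases Finset.mem_insert.1 hl with rfl | hl
        · exact absurd (hgood _ hlb) (not_le.2 hcon)
        · have := hnear i hi l (Finset.mem_compl.1 hl)
          linarith [hgood l hlb]
      have h2 := Finset.card_le_card hsub
      rw [Finset.card_insert_of_notMem (by simpa using hi)] at h2
      have h3 : (sᶜ.card : ℝ) + 1 ≤ bad.card := by exact_mod_cast h2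
      linarith
    have h1 := abs_le.1 h1
    have h2 := abs_le.1 hcr
    exact abs_le.2 ⟨by linarith, by linarith⟩
  -- At most $\alpha k$ selected entries are corrupted, each off by at most $3\Delta+\Delta$, and
  -- $\alpha k$ entries of size at most $\Delta$ are dropped: $4+1=5$. The sixth unit of the final
  -- constant comes from the change of normalization in `hdec`.
  have herr : |∑ i ∈ s, (u i - r) - ∑ i, (v i - r)| ≤ 5 * α * k * Δ := by
    have e1 : ∑ i ∈ s, (u i - r) - ∑ i, (v i - r)
        = ∑ i ∈ s, (u i - v i) - ∑ i ∈ sᶜ, (v i - r) := by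
      rw [← Finset.sum_add_sum_compl s (fun i => v i - r), ← sub_sub, ← Finset.sum_sub_distrib]
      simp
    have e2 : ∑ i ∈ s, (u i - v i) = ∑ i ∈ s ∩ bad, (u i - v i) := by
      symm
      apply Finset.sum_subset Finset.inter_subset_left
      intro i hi hib
      rw [hv i (fun hb => hib (Finset.mem_inter.2 ⟨hi, hb⟩)), sub_self]
    have b1 : |∑ i ∈ s ∩ bad, (u i - v i)| ≤ (s ∩ bad).card * (4 * Δ) := by
      refine (Finset.abs_sum_le_sum_abs _ _).trans ?_
      rw [← nsmul_eq_mul]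
      refine Finset.sum_le_card_nsmul _ _ _ fun i hi => ?_
      have h1 := abs_le.1 (h i)
      have h2 := abs_le.1 (hsel i (Finset.mem_inter.1 hi).1)
      exact abs_le.2 ⟨by linarith, by linarith⟩
    have b2 : |∑ i ∈ sᶜ, (v i - r)| ≤ sᶜ.card * Δ := by
      refine (Finset.abs_sum_le_sum_abs _ _).trans ?_
      rw [← nsmul_eq_mul]
      exact Finset.sum_le_card_nsmul _ _ _ fun i _ => h i
    have b3 : ((s ∩ bad).card : ℝ) ≤ α * k :=
      le_trans (by exact_mod_cast Finset.card_le_card Finset.inter_subset_right) hbad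
    rw [e1, e2]
    refine (abs_sub _ _).trans ?_
    rw [hcompl] at b2
    nlinarith
  have hvsum : |∑ i, (v i - r)| ≤ k * Δ := by
    refine (Finset.abs_sum_le_sum_abs _ _).trans ?_
    refine (Finset.sum_le_card_nsmul _ _ _ fun i _ => h i).trans ?_
    simp
  have h1α : 0 < 1 - α := by linarith
  have hdec : (1 / ((1 - α) * k)) * ∑ i ∈ s, u i - (1 / (k : ℝ)) * ∑ i, v i
      = (1 / ((1 - α) * k)) * (∑ i ∈ s, (u i - r) - ∑ i, (v i - r))
        + α / ((1 - α) * k) * ∑ i, (v i - r) := by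
    simp only [Finset.sum_sub_distrib, Finset.sum_const, nsmul_eq_mul, hs, Finset.card_univ,
      Fintype.card_fin]
    field_simp
    ring
  rw [hdec]
  refine (abs_add_le _ _).trans ?_
  rw [abs_mul, abs_mul, abs_of_pos (show 0 < 1 / ((1 - α) * k) by positivity),
    abs_of_nonneg (show 0 ≤ α / ((1 - α) * k) by positivity)]
  calc _ ≤ 1 / ((1 - α) * k) * (5 * α * k * Δ) + α / ((1 - α) * k) * (k * Δ) := by gcongr
    _ = _ := by field_simp; ring

theorem IsRobustMean.abs_sub_mean_le {d k : ℕ} (hk : 1 ≤ k) {α : ℝ} (hα : 0 ≤ α)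
    (hα' : α < 1 / 2) {u : Fin k → Vec d} {w : Vec d} (hw : IsRobustMean α u w) (j : Fin d)
    {v : Fin k → ℝ} {r Δ : ℝ} {bad : Finset (Fin k)} (hbad : (bad.card : ℝ) ≤ α * k)
    (hv : ∀ i ∉ bad, u i j = v i) (h : ∀ i, |v i - r| ≤ Δ) :
    |w j - (1 / (k : ℝ)) * ∑ i, v i| ≤ 6 * α / (1 - α) * Δ := by
  obtain ⟨c, hc, s, hs, hnear, hwj⟩ := hw j
  rw [hwj]
  exact hc.abs_trimmedMean_sub_mean_le hk hα hα' hbad hv h hs hnear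

theorem abs_mean_sub_le {k : ℕ} (hk : 1 ≤ k) {v : Fin k → ℝ} {r Δ : ℝ}
    (h : ∀ i, |v i - r| ≤ Δ) : |(1 / (k : ℝ)) * ∑ i, v i - r| ≤ Δ := by
  have hk0 : (0 : ℝ) < k := by exact_mod_cast hk
  have e : (1 / (k : ℝ)) * ∑ i, v i - r = (1 / (k : ℝ)) * ∑ i, (v i - r) := by
    simp only [Finset.sum_sub_distrib, Finset.sum_const, nsmul_eq_mul, Finset.card_univ,
      Fintype.card_fin]
    field_simp
  rw [e, abs_mul, abs_of_pos (by positivity)]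
  calc _ ≤ (1 / (k : ℝ)) * (k * Δ) := by
        gcongr
        refine (Finset.abs_sum_le_sum_abs _ _).trans ?_
        refine (Finset.sum_le_card_nsmul _ _ _ fun i _ => h i).trans ?_
        simp
    _ = Δ := by field_simp

/-- Robust aggregation over time and then over agents, compared coordinatewise with the overall
mean of reference values `v i τ` that agree with the data at honest agents and times. -/
theorem IsRobustMean.abs_nested_sub_mean_le {d m N : ℕ} (hm : 1 ≤ m) (hN : 1 ≤ N) {α₁ α₂ : ℝ}
    (h1 : 0 ≤ α₁) (h1' : α₁ < 1 / 2) (h2 : 0 ≤ α₂) (h2' : α₂ < 1 / 2)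
    {u : Fin N → Fin m → Vec d} {w : Fin N → Vec d} {ww : Vec d}
    (hww : IsRobustMean α₂ w ww) (hw : ∀ i, IsRobustMean α₁ (u i) (w i)) (j : Fin d)
    {v : Fin N → Fin m → ℝ} {r Δ : ℝ} (bad : Fin N → Finset (Fin m))
    (hv : ∀ i, ∀ τ ∉ bad i, u i τ j = v i τ) (h : ∀ i τ, |v i τ - r| ≤ Δ)
    (hbad : ((Finset.univ.filter fun i => α₁ * m < ((bad i).card : ℝ)).card : ℝ) ≤ α₂ * N) :
    |ww j - (1 / (N : ℝ)) * ∑ i, (1 / (m : ℝ)) * ∑ τ, v i τ|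
      ≤ (6 * α₁ / (1 - α₁) + 6 * α₂ / (1 - α₂) * (1 + 6 * α₁ / (1 - α₁))) * Δ := by
  set A₁ := 6 * α₁ / (1 - α₁)
  set A₂ := 6 * α₂ / (1 - α₂)
  set M : Fin N → ℝ := fun i => (1 / (m : ℝ)) * ∑ τ, v i τ
  set B := Finset.univ.filter fun i => α₁ * m < ((bad i).card : ℝ)
  have hΔ : 0 ≤ Δ := (abs_nonneg _).trans (h ⟨0, hN⟩ ⟨0, hm⟩)
  have hA₁ : 0 ≤ A₁ := div_nonneg (by linarith) (by linarith)
  -- The outer robust mean is compared with a hybrid family: actual temporal estimates of reliable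
  -- agents, ideal means for the others. It agrees with the data off `B` and lies within $A_1\Delta$
  -- of the ideal means everywhere.
  let vt : Fin N → ℝ := fun i => if i ∈ B then M i else w i j
  have hM : ∀ i, |M i - r| ≤ Δ := fun i => abs_mean_sub_le hm (h i)
  have hvM : ∀ i, |vt i - M i| ≤ A₁ * Δ := by
    intro i
    by_cases hi : i ∈ B
    · simp only [vt, hi, if_true, sub_self, abs_zero]
      positivity
    · simp only [vt, hi, if_false]
      refine (hw i).abs_sub_mean_le hm h1 h1' j ?_ (hv i) (h i)
      by_contra! hcon
      exact hi (Finset.mem_filter.2 ⟨Finset.mem_univ _, hcon⟩)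
  have hvr : ∀ i, |vt i - r| ≤ (1 + A₁) * Δ := by
    intro i
    have := abs_sub_le (vt i) (M i) r
    linarith [hM i, hvM i]
  have e1 := hww.abs_sub_mean_le hN h2 h2' j (v := vt) hbad (fun i hi => by simp [vt, hi]) hvr
  have e2 : |(1 / (N : ℝ)) * ∑ i, (vt i - M i) - 0| ≤ A₁ * Δ :=
    abs_mean_sub_le hN (fun i => by simpa using hvM i)
  rw [Finset.sum_sub_distrib, mul_sub, sub_zero] at e2
  have := abs_sub_le (ww j) ((1 / (N : ℝ)) * ∑ i, vt i) ((1 / (N : ℝ)) * ∑ i, M i)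
  change _ ≤ A₂ * _ at e1
  nlinarith

/-- Since $(1-\alpha)^2\ge1-2\alpha$, the square root in `Calpha` is at least 1, so `Calpha` is at
least $\frac{4\alpha}{1-\alpha}\sqrt d$. This converts the constant of the trimmed mean estimate
into that of the theorem. -/
theorem le_Calpha {d : ℕ} {α : ℝ} (h : 0 ≤ α) (h' : α < 1 / 2) :
    6 * α / (1 - α) * √(d : ℝ) ≤ 3 / 2 * Calpha d α := by
  have h1 : 1 ≤ √((1 - α) ^ 2 / (1 - 2 * α)) := by
    rw [Real.one_le_sqrt, one_le_div (by linarith)]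
    nlinarith [sq_nonneg α]
  have h2 : 0 ≤ α / (1 - α) * √(d : ℝ) :=
    mul_nonneg (div_nonneg h (by linarith)) (Real.sqrt_nonneg _)
  have e : 3 / 2 * Calpha d α
      = (α / (1 - α) * √(d : ℝ)) * (3 * (1 + √((1 - α) ^ 2 / (1 - 2 * α)))) := by
    unfold Calpha; ring
  rw [e]
  calc 6 * α / (1 - α) * √(d : ℝ) = (α / (1 - α) * √(d : ℝ)) * 6 := by ring
    _ ≤ _ := by gcongr; linarith

theorem Calpha_nonneg {d : ℕ} {α : ℝ} (h : 0 ≤ α) (h' : α < 1 / 2) : 0 ≤ Calpha d α := by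
  unfold Calpha
  have : 0 ≤ 2 * α / (1 - α) := div_nonneg (by linarith) (by linarith)
  positivity

theorem norm_le_sqrt_mul {d : ℕ} (u : Vec d) {c : ℝ} (h : ∀ j, |u j| ≤ c) :
    ‖u‖ ≤ √(d : ℝ) * c := by
  rcases Nat.eq_zero_or_pos d with rfl | hd
  · simp [EuclideanSpace.norm_eq]
  have hc : 0 ≤ c := (abs_nonneg _).trans (h ⟨0, hd⟩)
  rw [EuclideanSpace.norm_eq]
  apply Real.sqrt_le_iff.2
  refine ⟨by positivity, ?_⟩
  rw [mul_pow, Real.sq_sqrt (by positivity)]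
  refine (Finset.sum_le_card_nsmul _ _ (c ^ 2) fun j _ => ?_).trans (by simp)
  have := h j
  rw [Real.norm_eq_abs]
  gcongr

/-! ### The geometry of a normalized step -/

/-- A normalized inexact gradient of a strongly convex smooth function points away from the
minimizer. -/
theorem inner_normalized_ge {E : Type*} [NormedAddCommGroup E] [InnerProductSpace ℝ E]
    {v G y : E} {μ L : ℝ} (hμ : 0 < μ) (hμL : μ ≤ L)
    (h1 : μ * ‖y‖ ^ 2 ≤ inner ℝ G y) (h2 : ‖G‖ ≤ L * ‖y‖) :
    μ / L * ‖y‖ - 2 / μ * ‖v - G‖ ≤ inner ℝ (‖v‖⁻¹ • v) y := by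
  have hL : 0 < L := hμ.trans_le hμL
  have hr : μ / L ≤ 1 := (div_le_one hL).2 hμL
  have hr' : 1 ≤ L / μ := (one_le_div hμ).2 hμL
  set δ := ‖y‖
  set e := ‖v - G‖
  have hδ : 0 ≤ δ := norm_nonneg _
  have he : 0 ≤ e := norm_nonneg _
  have hI : μ * δ ^ 2 - e * δ ≤ inner ℝ v y := by
    have h3 : inner ℝ v y = inner ℝ G y + inner ℝ (v - G) y := by
      rw [← inner_add_left]; congr 1; abel
    have h4 := abs_le.1 (abs_real_inner_le_norm (v - G) y)
    rw [h3]; linarith [h4.1]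
  -- If the error dominates, the claim is weaker than Cauchy–Schwarz. Otherwise `hI` is divided by
  -- $\|v\|\le L\delta+e$.
  have hlarge : μ * δ ≤ e → μ / L * δ - 2 / μ * e ≤ -δ := by
    intro h
    have : δ ≤ e / μ := by rw [le_div_iff₀ hμ]; linarith
    have h3 : μ / L * δ ≤ 1 * δ := by gcongr
    have h4 : 2 / μ * e = 2 * (e / μ) := by ring
    linarith
  have hup : -δ ≤ inner ℝ (‖v‖⁻¹ • v) y := by
    have h4 := abs_le.1 (abs_real_inner_le_norm (‖v‖⁻¹ • v) y)
    have h5 : ‖‖v‖⁻¹ • v‖ ≤ 1 := by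
      rw [norm_smul, norm_inv, norm_norm]
      exact inv_mul_le_one
    have h6 : ‖‖v‖⁻¹ • v‖ * ‖y‖ ≤ 1 * δ := by gcongr
    linarith [h4.1]
  rcases le_total (μ * δ) e with h | h
  · exact (hlarge h).trans hup
  have hV : ‖v‖ ≤ L * δ + e := by
    have : v = G + (v - G) := by abel
    rw [this]
    exact (norm_add_le _ _).trans (by linarith)
  rcases (norm_nonneg v).eq_or_lt with h0 | h0
  · have hv : v = 0 := norm_eq_zero.1 h0.symm
    have h3 : μ * δ ≤ e := by
      have : μ * δ ^ 2 ≤ e * δ := by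
        rw [hv, inner_zero_left] at hI; linarith
      rcases hδ.eq_or_lt with h4 | h4
      · rw [← h4]; simpa using he
      · nlinarith
    exact (hlarge h3).trans hup
  rw [real_inner_smul_left, inv_mul_eq_div, le_div_iff₀ h0]
  refine le_trans ?_ hI
  -- The upper bound on $\|v\|$ helps only if its factor is nonnegative. If the factor is
  -- nonpositive, so is its product with $\|v\|$, while $\mu\delta^2-e\delta\ge0$ because
  -- $e\le\mu\delta$.
  rcases le_total (μ / L * δ - 2 / μ * e) 0 with h3 | h3
  · nlinarith [mul_nonneg hδ (sub_nonneg.2 h), mul_nonpos_of_nonpos_of_nonneg h3 h0.le]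
  calc _ ≤ (μ / L * δ - 2 / μ * e) * (L * δ + e) := by gcongr
    _ = μ * δ ^ 2 + e * δ * (μ / L - 2 * (L / μ)) - 2 / μ * e ^ 2 := by field_simp; ring
    _ ≤ μ * δ ^ 2 + e * δ * (-1) - 0 := by
        gcongr
        · linarith
        · positivity
    _ = _ := by ring

theorem IsProjection.norm_sub_le {d : ℕ} {X : Set (Vec d)} (hX : Convex ℝ X) {u p y : Vec d}
    (h : IsProjection X u p) (hy : y ∈ X) : ‖p - y‖ ≤ ‖u - y‖ := by
  have hmin : ‖u - p‖ = ⨅ w : X, ‖u - w‖ := by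
    have : Nonempty X := ⟨⟨p, h.1⟩⟩
    apply le_antisymm
    · exact le_ciInf fun w => h.2 w w.2
    · exact ciInf_le ⟨0, by rintro _ ⟨w, rfl⟩; exact norm_nonneg _⟩ (⟨p, h.1⟩ : X)
  have hin := (norm_eq_iInf_iff_real_inner_le_zero hX h.1).1 hmin y hy
  have e : u - y = (u - p) + (p - y) := by abel
  have e2 : inner ℝ (u - p) (p - y) = - inner ℝ (u - p) (y - p) := by
    rw [← inner_neg_right, neg_sub]
  have h3 := norm_add_sq_real (u - p) (p - y)
  rw [← e] at h3
  apply le_of_sq_le_sq _ (norm_nonneg _)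
  nlinarith [sq_nonneg ‖u - p‖]

theorem norm_normalized_le_one {E : Type*} [NormedAddCommGroup E] [NormedSpace ℝ E] (v : E) :
    ‖‖v‖⁻¹ • v‖ ≤ 1 := by
  rw [norm_smul, norm_inv, norm_norm]
  exact inv_mul_le_one

theorem IsProjection.norm_step_le {d : ℕ} {X : Set (Vec d)} (hX : Convex ℝ X) {x p v : Vec d}
    {γ : ℝ} (hγ : 0 ≤ γ) (h : IsProjection X (x - γ • (‖v‖⁻¹ • v)) p) (hx : x ∈ X) :
    ‖p - x‖ ≤ γ := by
  refine (h.norm_sub_le hX hx).trans ?_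
  rw [sub_sub_cancel_left, norm_neg, norm_smul, Real.norm_of_nonneg hγ]
  exact mul_le_of_le_one_right hγ (norm_normalized_le_one v)

/-- One projected normalized step. -/
theorem IsProjection.sq_norm_step_le {d : ℕ} {X : Set (Vec d)} (hX : Convex ℝ X)
    {x p v y : Vec d} {γ : ℝ} (h : IsProjection X (x - γ • (‖v‖⁻¹ • v)) p) (hy : y ∈ X) :
    ‖p - y‖ ^ 2 ≤ ‖x - y‖ ^ 2 - 2 * γ * inner ℝ (‖v‖⁻¹ • v) (x - y) + γ ^ 2 := by
  have h1 := h.norm_sub_le hX hy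
  have e : x - γ • (‖v‖⁻¹ • v) - y = (x - y) - γ • (‖v‖⁻¹ • v) := by abel
  rw [e] at h1
  have h2 : ‖p - y‖ ^ 2 ≤ ‖(x - y) - γ • (‖v‖⁻¹ • v)‖ ^ 2 := by gcongr
  rw [norm_sub_sq_real (x - y) (γ • (‖v‖⁻¹ • v)), real_inner_smul_right,
    real_inner_comm, norm_smul, mul_pow] at h2
  have h3 : ‖γ‖ ^ 2 * ‖‖v‖⁻¹ • v‖ ^ 2 ≤ ‖γ‖ ^ 2 * 1 := by
    gcongr
    exact pow_le_one₀ (norm_nonneg _) (norm_normalized_le_one v)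
  have h4 : ‖γ‖ ^ 2 = γ ^ 2 := by rw [Real.norm_eq_abs, sq_abs]
  rw [h4] at h2 h3
  linarith

theorem neg_norm_le_inner_normalized {E : Type*} [NormedAddCommGroup E] [InnerProductSpace ℝ E]
    (v y : E) : -‖y‖ ≤ inner ℝ (‖v‖⁻¹ • v) y := by
  have h4 := abs_le.1 (abs_real_inner_le_norm (‖v‖⁻¹ • v) y)
  have h6 : ‖‖v‖⁻¹ • v‖ * ‖y‖ ≤ 1 * ‖y‖ := by
    gcongr
    exact norm_normalized_le_one v
  linarith [h4.1]

/-! ### Sub-gamma variables -/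

theorem IsSubGamma.neg {Z : Type*} [MeasurableSpace Z] {D : Measure Z}
    {Y : Z → ℝ} {σ a : ℝ} (h : IsSubGamma D Y σ a) : IsSubGamma D (fun z => -Y z) σ a := by
  intro l hl
  have := h (-l) (by rwa [abs_neg])
  simpa [neg_mul, mul_neg] using this

section SubGamma

variable {Z : Type*} [MeasurableSpace Z] {D : Measure Z} [IsProbabilityMeasure D]
  {Y : Z → ℝ} {σ a : ℝ}

theorem IsSubGamma.mgf_le (h : IsSubGamma D Y σ a) {l : ℝ} (hl : a * |l| < 1) :
    ∫ z, Real.exp (l * Y z) ∂D ≤ Real.exp (l ^ 2 * σ ^ 2 / (2 * (1 - a * |l|))) := by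
  obtain ⟨h1, h2⟩ := h l hl
  rwa [Real.log_le_iff_le_exp (integral_exp_pos h1)] at h2

theorem IsSubGamma.mgf_le_of_le_half (h : IsSubGamma D Y σ a) {l : ℝ}
    (hl : a * |l| ≤ 1 / 2) :
    ∫ z, Real.exp (l * Y z) ∂D ≤ Real.exp (l ^ 2 * σ ^ 2) := by
  refine (h.mgf_le (by linarith)).trans (Real.exp_le_exp.2 ?_)
  apply div_le_self (by positivity)
  linarith

/-- Add $e^v\ge1+v+v^2/2$ and $e^{-v}\ge1-v$ for $v=|u|$. It turns exponential moments at $\pm l$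
into second moments. -/
theorem sq_le_exp_add_exp (u : ℝ) : u ^ 2 ≤ 2 * (Real.exp u + Real.exp (-u) - 2) := by
  have key : ∀ v : ℝ, 0 ≤ v → v ^ 2 ≤ 2 * (Real.exp v + Real.exp (-v) - 2) := by
    intro v hv
    have h1 := Real.quadratic_le_exp_of_nonneg hv
    have h2 := Real.add_one_le_exp (-v)
    linarith
  rcases le_total 0 u with h | h
  · exact key u h
  · have := key (-u) (by linarith)
    rw [neg_neg] at this
    linarith [neg_sq u]

theorem IsSubGamma.memLp_two (h : IsSubGamma D Y σ a) (ha : 0 ≤ a) (hY : Measurable Y) :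
    MemLp Y 2 D := by
  set l : ℝ := 1 / (2 * a + 1)
  have hl : 0 < l := by positivity
  have hal : a * |l| < 1 := by
    rw [abs_of_pos hl, mul_one_div, div_lt_one (by positivity)]; linarith
  have h1 := (h l hal).1
  have h2 := (h (-l) (by rwa [abs_neg])).1
  rw [memLp_two_iff_integrable_sq hY.aestronglyMeasurable]
  refine (((h1.add h2).sub (integrable_const 2)).const_mul (2 / l ^ 2)).mono'
    (hY.pow_const 2).aestronglyMeasurable (Filter.Eventually.of_forall fun z => ?_)
  rw [Real.norm_of_nonneg (sq_nonneg _)]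
  have := sq_le_exp_add_exp (l * Y z)
  simp only [Pi.add_apply, Pi.sub_apply, neg_mul]
  rw [div_mul_eq_mul_div, le_div_iff₀ (by positivity)]
  linarith [mul_pow l (Y z) 2]

theorem IsSubGamma.integrable (h : IsSubGamma D Y σ a) (ha : 0 ≤ a) (hY : Measurable Y) :
    Integrable Y D :=
  (h.memLp_two ha hY).integrable (by norm_num)

/-- Centering is implied by the sub-gamma bound: $1+l\,\mathbb EY\le\mathbb Ee^{lY}\le
e^{l^2\sigma^2}\le1+2l^2\sigma^2$, so $\mathbb EY\le2l\sigma^2$ for all small $l>0$. -/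
theorem IsSubGamma.integral_nonpos (h : IsSubGamma D Y σ a) (ha : 0 ≤ a) (hY : Measurable Y) :
    ∫ z, Y z ∂D ≤ 0 := by
  have hi := h.integrable ha hY
  refine le_of_forall_pos_le_add fun ε hε => ?_
  -- The first entry ensures $al\le1/2$, $l\sigma^2\le1$ and $l\le1$; the second ensures
  -- $2l\sigma^2\le\varepsilon$.
  set l : ℝ := min (1 / (2 * a + σ ^ 2 + 1)) (ε / (2 * (σ ^ 2 + 1)))
  have hl : 0 < l := by positivity
  have hl1 : l ≤ 1 / (2 * a + σ ^ 2 + 1) := min_le_left _ _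
  have hl2 : l ≤ ε / (2 * (σ ^ 2 + 1)) := min_le_right _ _
  rw [le_div_iff₀ (by positivity)] at hl1 hl2
  have hal : a * |l| ≤ 1 / 2 := by
    rw [abs_of_pos hl]
    nlinarith [sq_nonneg σ]
  have hls : l * σ ^ 2 ≤ 1 := by nlinarith
  have hl3 : l ≤ 1 := by nlinarith [mul_nonneg hl.le ha, mul_nonneg hl.le (sq_nonneg σ)]
  have h1 := (h l (by linarith)).1
  have h2 := h.mgf_le_of_le_half hal
  have h3 : 1 + l * ∫ z, Y z ∂D ≤ ∫ z, Real.exp (l * Y z) ∂D := by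
    have : ∫ z, (1 + l * Y z) ∂D ≤ ∫ z, Real.exp (l * Y z) ∂D := by
      refine integral_mono ((integrable_const _).add (hi.const_mul l)) h1 fun z => ?_
      have := Real.add_one_le_exp (l * Y z)
      dsimp only
      linarith
    rwa [integral_add (integrable_const _) (hi.const_mul l), integral_const_mul,
      integral_const, probReal_univ, one_smul] at this
  have h4 : Real.exp (l ^ 2 * σ ^ 2) ≤ 1 + 2 * (l ^ 2 * σ ^ 2) := by
    have h0 : 0 ≤ l ^ 2 * σ ^ 2 := by positivity
    have h5 : l ^ 2 * σ ^ 2 ≤ 1 := by nlinarith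
    have := Real.abs_exp_sub_one_le (x := l ^ 2 * σ ^ 2) (by rwa [abs_of_nonneg h0])
    rw [abs_of_nonneg h0] at this
    linarith [(abs_le.1 this).2]
  have h5 : l * ∫ z, Y z ∂D ≤ l * (2 * (l * σ ^ 2)) := by nlinarith
  have h6 := le_of_mul_le_mul_left h5 hl
  linarith

theorem IsSubGamma.integral_eq_zero (h : IsSubGamma D Y σ a) (ha : 0 ≤ a) (hY : Measurable Y) :
    ∫ z, Y z ∂D = 0 := by
  have h1 := h.integral_nonpos ha hY
  have h2 := h.neg.integral_nonpos ha hY.neg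
  rw [integral_neg] at h2
  linarith

/-- At a scale with $al\le1/2$ and $l\sigma\le1$, $l^2\mathbb
EY^2\le2(2e^{l^2\sigma^2}-2)\le8l^2\sigma^2$. An absolute factor in front of $\sigma^2$ is harmless.
-/
theorem IsSubGamma.integral_sq_le (h : IsSubGamma D Y σ a) (ha : 0 ≤ a) (hσ : 0 ≤ σ)
    (hY : Measurable Y) : ∫ z, Y z ^ 2 ∂D ≤ 8 * σ ^ 2 := by
  set l : ℝ := 1 / (2 * a + σ + 1)
  have hl : 0 < l := by positivity
  have hl1 : l * (2 * a + σ + 1) = 1 := by simp only [l]; field_simp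
  have hal : a * |l| ≤ 1 / 2 := by
    rw [abs_of_pos hl]
    nlinarith
  have hls : l * σ ≤ 1 := by nlinarith
  have h1 := (h l (by linarith)).1
  have h2 := (h (-l) (by rw [abs_neg]; linarith)).1
  have h3 := h.mgf_le_of_le_half hal
  have h4 := h.mgf_le_of_le_half (l := -l) (by rwa [abs_neg])
  rw [neg_sq] at h4
  have h5 : ∫ z, (l * Y z) ^ 2 ∂D
      ≤ ∫ z, 2 * (Real.exp (l * Y z) + Real.exp (-l * Y z) - 2) ∂D := by
    refine integral_mono ?_ (((h1.add h2).sub (integrable_const 2)).const_mul 2) fun z => ?_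
    · simp_rw [mul_pow]
      exact ((h.memLp_two ha hY).integrable_sq).const_mul _
    · have := sq_le_exp_add_exp (l * Y z)
      rwa [← neg_mul] at this
  have h12 : Integrable (fun z => Real.exp (l * Y z) + Real.exp (-l * Y z)) D := h1.add h2
  rw [integral_const_mul, integral_sub h12 (integrable_const 2), integral_add h1 h2,
    integral_const, probReal_univ, one_smul] at h5
  simp_rw [mul_pow] at h5
  rw [integral_const_mul] at h5
  have h6 : Real.exp (l ^ 2 * σ ^ 2) ≤ 1 + 2 * (l ^ 2 * σ ^ 2) := by
    have h0 : 0 ≤ l ^ 2 * σ ^ 2 := by positivity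
    have h5 : l ^ 2 * σ ^ 2 ≤ 1 := by
      rw [← mul_pow]; exact pow_le_one₀ (by positivity) hls
    have := Real.abs_exp_sub_one_le (x := l ^ 2 * σ ^ 2) (by rwa [abs_of_nonneg h0])
    rw [abs_of_nonneg h0] at this
    linarith [(abs_le.1 this).2]
  refine le_of_mul_le_mul_left (a := l ^ 2) ?_ (by positivity)
  linarith

end SubGamma

/-! ### Gradients -/

theorem hasLineDerivAt_gradient {d : ℕ} {h : Vec d → ℝ} (hh : Differentiable ℝ h) (x : Vec d)
    (k : Fin d) : HasLineDerivAt ℝ h (gradient h x k) x (EuclideanSpace.single k (1 : ℝ)) := by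
  have h1 := (hh x).hasGradientAt.hasFDerivAt.hasLineDerivAt (EuclideanSpace.single k (1 : ℝ))
  have h2 : InnerProductSpace.toDual ℝ (Vec d) (gradient h x) (EuclideanSpace.single k (1 : ℝ))
      = gradient h x k := by
    rw [InnerProductSpace.toDual_apply_apply, EuclideanSpace.inner_single_right]
    simp
  rwa [h2] at h1

theorem tendsto_gradient_coord {d : ℕ} {h : Vec d → ℝ} (hh : Differentiable ℝ h) (x : Vec d)
    (k : Fin d) :
    Filter.Tendsto (fun n : ℕ => ((n : ℝ) + 1) *
        (h (x + (1 / ((n : ℝ) + 1)) • EuclideanSpace.single k (1 : ℝ)) - h x))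
      Filter.atTop (nhds (gradient h x k)) := by
  have h1 := (hasLineDerivAt_gradient hh x k).tendsto_slope_zero
  have h2 : Filter.Tendsto (fun n : ℕ => 1 / ((n : ℝ) + 1)) Filter.atTop
      (nhdsWithin 0 {0}ᶜ) :=
    tendsto_nhdsWithin_iff.2 ⟨tendsto_one_div_add_atTop_nhds_zero_nat,
      Filter.Eventually.of_forall fun n => by
        have : (0 : ℝ) < 1 / ((n : ℝ) + 1) := by positivity
        exact this.ne'⟩
  refine (h1.comp h2).congr fun n => ?_
  simp

/-- A function continuous in $x$ and measurable in $z$ is jointly measurable, and a partial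
derivative is a pointwise limit of difference quotients. Joint measurability is needed because the
iterate is random. -/
theorem measurable_gradient_coord {d : ℕ} {Z : Type*} [MeasurableSpace Z] {f : Vec d → Z → ℝ}
    (hf : ∀ x, Measurable (f x)) (hd : ∀ z, Differentiable ℝ fun y => f y z) (k : Fin d) :
    Measurable fun q : Vec d × Z => gradient (fun y => f y q.2) q.1 k := by
  have h0 : Measurable fun q : Vec d × Z => f q.1 q.2 := by
    have h := measurable_uncurry_of_continuous_of_measurable (u := fun (x : Vec d) (z : Z) => f x z)
      (fun z => (hd z).continuous) hf
    exact h
  refine measurable_of_tendsto_metrizable (f := fun (n : ℕ) (q : Vec d × Z) => ((n : ℝ) + 1) *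
        (f (q.1 + (1 / ((n : ℝ) + 1)) • EuclideanSpace.single k (1 : ℝ)) q.2 - f q.1 q.2)) ?_ ?_
  · intro n
    have h1 : Measurable fun q : Vec d × Z =>
        f (q.1 + (1 / ((n : ℝ) + 1)) • EuclideanSpace.single k (1 : ℝ)) q.2 :=
      h0.comp ((measurable_fst.add_const _).prodMk measurable_snd)
    exact (h1.sub h0).const_mul _
  · rw [tendsto_pi_nhds]
    exact fun q => tendsto_gradient_coord (hd q.2) q.1 k

theorem measurable_gradient {d : ℕ} (h : Vec d → ℝ) : Measurable (gradient h) := by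
  have h1 : Measurable fun x => fderiv ℝ h x := measurable_fderiv ℝ h
  exact ((InnerProductSpace.toDual ℝ (Vec d)).symm.continuous.measurable).comp h1

theorem gradient_empiricalRisk {d b : ℕ} {Z : Type*} {f : Vec d → Z → ℝ}
    (hd : ∀ z, Differentiable ℝ fun y => f y z) (z : Fin b → Z) (x : Vec d) :
    gradient (empiricalRisk f z) x
      = (1 / (b : ℝ)) • ∑ j, gradient (fun y => f y (z j)) x := by
  apply HasGradientAt.gradient
  rw [hasGradientAt_iff_hasFDerivAt, map_smul, map_sum]
  exact (HasFDerivAt.fun_sum fun j _ => ((hd (z j)) x).hasGradientAt.hasFDerivAt).const_mul _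

/-- The population gradient inherits Lipschitz continuity from the samples' gradients. -/
theorem norm_gradient_risk_sub_le {d : ℕ} {Z : Type*} [MeasurableSpace Z] {D : Measure Z}
    [IsProbabilityMeasure D] {f : Vec d → Z → ℝ} {X : Set (Vec d)} {L σ a : ℝ} (ha : 0 ≤ a)
    (hf : ∀ x, Measurable (f x))
    (hsg : ∀ k : Fin d, ∀ x ∈ X, IsSubGamma D
      (fun z => gradient (fun y => f y z) x k - gradient (risk D f) x k) σ a)
    (hs : ∀ z, IsSmoothOn X L (fun y => f y z)) {x y : Vec d} (hx : x ∈ X) (hy : y ∈ X) :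
    ‖gradient (risk D f) x - gradient (risk D f) y‖ ≤ L * ‖x - y‖ := by
  have hmeas : ∀ (x : Vec d) (k : Fin d), Measurable fun z => gradient (fun y => f y z) x k :=
    fun x k => (measurable_gradient_coord hf (fun z => (hs z).1) k).comp measurable_prodMk_left
  have hint : ∀ x ∈ X, ∀ k, Integrable (fun z => gradient (fun y => f y z) x k) D := by
    intro x hx k
    have := ((hsg k x hx).integrable ha ((hmeas x k).sub_const _)).add
      (integrable_const (gradient (risk D f) x k))
    exact this.congr (Filter.Eventually.of_forall fun z => sub_add_cancel _ _)
  -- Sub-gamma noise is centered, so no differentiation under the integral sign has to be justified.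
  have hmean : ∀ x ∈ X, ∀ k, ∫ z, gradient (fun y => f y z) x k ∂D = gradient (risk D f) x k := by
    intro x hx k
    have := (hsg k x hx).integral_eq_zero ha ((hmeas x k).sub_const _)
    rw [integral_sub (hint x hx k) (integrable_const _), integral_const, probReal_univ,
      one_smul] at this
    linarith
  let G : Z → Vec d := fun z => gradient (fun y => f y z) x - gradient (fun y => f y z) y
  have hG : ∀ k, Integrable (fun z => G z k) D := fun k =>
    (hint x hx k).sub (hint y hy k)
  have hGi : gradient (risk D f) x - gradient (risk D f) y = ∫ z, G z ∂D := by
    ext k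
    rw [eval_integral_piLp hG]
    simp only [G, PiLp.sub_apply]
    rw [integral_sub (hint x hx k) (hint y hy k), hmean x hx k, hmean y hy k]
  rw [hGi]
  refine (norm_integral_le_of_norm_le_const
    (Filter.Eventually.of_forall fun z => (hs z).2 x hx y hy)).trans ?_
  simp

/-! ### Fresh samples and the gradient noise -/

/-- Independence of the past makes the joint law a product, so whatever is known after iteration
`t`, the next iterate in particular, can be frozen while the new samples are integrated out. With
values in `ENNReal` no integrability has to be known beforehand. -/
theorem IsEnvironment.lintegral_fresh {Ω Z : Type*} [mΩ : MeasurableSpace Ω] [MeasurableSpace Z]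
    {P : Measure Ω} [IsProbabilityMeasure P] {ℱ : Filtration ℕ mΩ} {D : Measure Z}
    [IsProbabilityMeasure D] {pb pt : ℝ} {H N b : ℕ} {W : ℕ → Fin N → Ω → Bool}
    {z : ℕ → Fin N → Fin b → Ω → Z} (h : IsEnvironment P ℱ D pb pt H W z) {t : ℕ} (ht : t < H)
    {E : Type*} [MeasurableSpace E] {U : Ω → E} (hU : Measurable[ℱ t] U)
    {φ : E × (Fin N → Fin b → Z) → ENNReal} (hφ : Measurable φ) :
    ∫⁻ ω, φ (U ω, fun i j => z (t + 1) i j ω) ∂P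
      = ∫⁻ ω, ∫⁻ ζ, φ (U ω, ζ) ∂(Measure.pi fun _ => Measure.pi fun _ => D) ∂P := by
  have hU' : Measurable U := hU.mono (ℱ.le t) le_rfl
  have hz : Measurable fun ω (i : Fin N) (j : Fin b) => z (t + 1) i j ω :=
    measurable_pi_iff.2 fun i => measurable_pi_iff.2 fun j =>
      (h.sample_adapted (t + 1) (by omega) ht i j).mono (ℱ.le _) le_rfl
  have hind : IndepFun U (fun ω (i : Fin N) (j : Fin b) => z (t + 1) i j ω) P := by
    refine IndepFun.symm ?_
    rw [IndepFun_iff_Indep]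
    exact indep_of_indep_of_le_right (h.sample_fresh t ht) (hU.comap_le.trans le_sup_left)
  have hlaw := (indepFun_iff_map_prod_eq_prod_map_map hU'.aemeasurable hz.aemeasurable).1 hind
  rw [h.sample_law (t + 1) (by omega) ht] at hlaw
  rw [← lintegral_map (f := φ) hφ (hU'.prodMk hz), hlaw, lintegral_prod _ hφ.aemeasurable,
    lintegral_map hφ.lintegral_prod_right' hU']

/-- The `k`-th coordinate of the gradient noise of one sample. -/
def sampleNoise {d : ℕ} {Z : Type*} [MeasurableSpace Z] (D : Measure Z) (f : Vec d → Z → ℝ)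
    (k : Fin d) (x : Vec d) (z : Z) : ℝ :=
  gradient (fun y => f y z) x k - gradient (risk D f) x k

/-- The `k`-th coordinate of the gradient noise of a minibatch. -/
def batchNoise {d b : ℕ} {Z : Type*} [MeasurableSpace Z] (D : Measure Z) (f : Vec d → Z → ℝ)
    (k : Fin d) (x : Vec d) (ζ : Fin b → Z) : ℝ :=
  (1 / (b : ℝ)) * ∑ j, sampleNoise D f k x (ζ j)

section Noise

variable {d N b : ℕ} {Z : Type*} [MeasurableSpace Z] {D : Measure Z}
  {f : Vec d → Z → ℝ} {σ a : ℝ} {k : Fin d}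

theorem gradient_empiricalRisk_coord (hb : 1 ≤ b) (hd : ∀ z, Differentiable ℝ fun y => f y z)
    (ζ : Fin b → Z) (x : Vec d) :
    gradient (empiricalRisk f ζ) x k = gradient (risk D f) x k + batchNoise D f k x ζ := by
  have hb0 : (0 : ℝ) < b := by exact_mod_cast hb
  rw [gradient_empiricalRisk hd, batchNoise]
  simp only [PiLp.smul_apply, WithLp.ofLp_sum, Finset.sum_apply, smul_eq_mul, sampleNoise,
    Finset.sum_sub_distrib, Finset.sum_const, Finset.card_univ, Fintype.card_fin, nsmul_eq_mul]
  field_simp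
  ring

theorem measurable_sampleNoise (hf : ∀ x, Measurable (f x))
    (hd : ∀ z, Differentiable ℝ fun y => f y z) :
    Measurable fun q : Vec d × Z => sampleNoise D f k q.1 q.2 := by
  refine (measurable_gradient_coord hf hd k).sub ?_
  have h1 : Measurable fun v : Vec d => v k := by fun_prop
  exact h1.comp ((measurable_gradient (risk D f)).comp measurable_fst)

theorem measurable_batchNoise (hf : ∀ x, Measurable (f x))
    (hd : ∀ z, Differentiable ℝ fun y => f y z) :
    Measurable fun q : Vec d × (Fin b → Z) => batchNoise D f k q.1 q.2 := by
  refine (Finset.measurable_sum _ fun j _ => ?_).const_mul _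
  have h1 : Measurable fun q : Vec d × (Fin b → Z) => (q.1, q.2 j) := by fun_prop
  exact (measurable_sampleNoise hf hd).comp h1

theorem measurable_batchNoise_comp (hf : ∀ x, Measurable (f x))
    (hd : ∀ z, Differentiable ℝ fun y => f y z) {Ω : Type*} {mΩ : MeasurableSpace Ω}
    {x : Ω → Vec d} (hx : Measurable x) {ζ : Fin b → Ω → Z} (hζ : ∀ j, Measurable (ζ j)) :
    Measurable fun ω => batchNoise D f k (x ω) (fun j => ζ j ω) := by
  have h : Measurable fun ω => (x ω, fun j => ζ j ω) := hx.prodMk (measurable_pi_iff.2 hζ)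
  have h2 := Measurable.comp (measurable_batchNoise (D := D) (k := k) hf hd) h
  exact h2

theorem measurable_sum_range_sum {Ω : Type*} {mΩ : MeasurableSpace Ω} {n : ℕ}
    {h : ℕ → Fin N → Ω → ℝ} (hh : ∀ r < n, ∀ i, Measurable (h r i)) :
    Measurable fun ω => ∑ r ∈ Finset.range n, ∑ i, h r i ω :=
  Finset.measurable_sum _ fun r hr => Finset.measurable_sum _ fun i _ =>
    hh r (Finset.mem_range.1 hr) i

variable [IsProbabilityMeasure D]

/-- The exponential factorizes over the $b$ independent samples, each taken at $l/b$, and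
$b\,(l/b)^2\sigma^2=l^2\sigma^2/b$. -/
theorem integral_exp_batchNoise_le (hb : 1 ≤ b) {x : Vec d}
    (hsg : IsSubGamma D (sampleNoise D f k x) σ a) {l : ℝ} (hl : a * |l| ≤ b / 2) :
    Integrable (fun ζ : Fin b → Z => Real.exp (l * batchNoise D f k x ζ)) (Measure.pi fun _ => D) ∧
    ∫ ζ : Fin b → Z, Real.exp (l * batchNoise D f k x ζ) ∂(Measure.pi fun _ => D)
      ≤ Real.exp (l ^ 2 * σ ^ 2 / b) := by
  have hb0 : (0 : ℝ) < b := by exact_mod_cast hb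
  have hl' : a * |l / b| ≤ 1 / 2 := by
    rw [abs_div, Nat.abs_cast, ← mul_div_assoc, div_le_iff₀ hb0]
    linarith
  have e : (fun ζ : Fin b → Z => Real.exp (l * batchNoise D f k x ζ))
      = fun ζ => ∏ j, Real.exp (l / b * sampleNoise D f k x (ζ j)) := by
    funext ζ
    rw [← Real.exp_sum, batchNoise, ← Finset.mul_sum]
    ring_nf
  rw [e]
  refine ⟨Integrable.fintype_prod fun _ => (hsg (l / b) (by linarith)).1, ?_⟩
  rw [integral_fintype_prod_eq_pow (fun z => Real.exp (l / b * sampleNoise D f k x z)),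
    Fintype.card_fin]
  calc _ ≤ Real.exp ((l / b) ^ 2 * σ ^ 2) ^ b :=
        pow_le_pow_left₀ (integral_nonneg fun _ => (Real.exp_pos _).le)
          (hsg.mgf_le_of_le_half hl') b
    _ = _ := by
        rw [← Real.exp_nat_mul]
        congr 1
        field_simp

theorem lintegral_exp_batchNoise_le (hb : 1 ≤ b) {x : Vec d}
    (hsg : IsSubGamma D (sampleNoise D f k x) σ a) {l : ℝ} (hl : a * |l| ≤ b / 2) (i : Fin N) :
    ∫⁻ ζ : Fin N → Fin b → Z, ENNReal.ofReal (Real.exp (l * batchNoise D f k x (ζ i)))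
        ∂(Measure.pi fun _ => Measure.pi fun _ => D)
      ≤ ENNReal.ofReal (Real.exp (l ^ 2 * σ ^ 2 / b)) := by
  obtain ⟨h1, h2⟩ := integral_exp_batchNoise_le hb hsg hl
  rw [← ofReal_integral_eq_lintegral_ofReal
    (integrable_comp_eval (μ := fun _ : Fin N => Measure.pi fun _ : Fin b => D) (i := i) h1)
    (Filter.Eventually.of_forall fun _ => (Real.exp_pos _).le),
    integral_comp_eval (μ := fun _ : Fin N => Measure.pi fun _ : Fin b => D) (i := i)
      h1.aestronglyMeasurable]
  exact ENNReal.ofReal_le_ofReal h2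

/-- The noise added over all agents has mean zero and small second moment. -/
theorem lintegral_add_sum_batchNoise_sq_le (hb : 1 ≤ b) (ha : 0 ≤ a) (hσ : 0 ≤ σ) {x : Vec d}
    (hm : Measurable (sampleNoise D f k x)) (hsg : IsSubGamma D (sampleNoise D f k x) σ a)
    (A : ℝ) :
    ∫⁻ ζ : Fin N → Fin b → Z, ENNReal.ofReal ((A + ∑ i, batchNoise D f k x (ζ i)) ^ 2)
        ∂(Measure.pi fun _ => Measure.pi fun _ => D)
      ≤ ENNReal.ofReal (A ^ 2) + ENNReal.ofReal (8 * N * σ ^ 2 / b) := by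
  have hb0 : (0 : ℝ) < b := by exact_mod_cast hb
  have hY := hsg.memLp_two ha hm
  have hY0 := hsg.integral_eq_zero ha hm
  have hYv : Var[sampleNoise D f k x; D] ≤ 8 * σ ^ 2 := by
    rw [variance_of_integral_eq_zero hm.aemeasurable hY0]
    exact hsg.integral_sq_le ha hσ hm
  let B : (Fin b → Z) → ℝ := ∑ j, fun ζ => sampleNoise D f k x (ζ j)
  have hev : ∀ j : Fin b, MemLp (fun ζ : Fin b → Z => sampleNoise D f k x (ζ j)) 2
      (Measure.pi fun _ => D) := fun j =>
    hY.comp_measurePreserving (measurePreserving_eval (fun _ : Fin b => D) j)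
  have hB : MemLp B 2 (Measure.pi fun _ => D) := memLp_finsetSum' _ fun j _ => hev j
  have hBv : Var[B; Measure.pi fun _ => D] ≤ b * (8 * σ ^ 2) := by
    have := variance_sum_pi (μ := fun _ : Fin b => D) (X := fun _ => sampleNoise D f k x)
      (fun _ => hY)
    rw [this]
    simpa using mul_le_mul_of_nonneg_left hYv hb0.le
  have hB0 : ∫ ζ, B ζ ∂(Measure.pi fun _ => D) = 0 := by
    simp only [B, Finset.sum_apply]
    rw [integral_finsetSum _ fun j _ => (hev j).integrable (by norm_num)]
    refine Finset.sum_eq_zero fun j _ => ?_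
    rw [integral_comp_eval (μ := fun _ : Fin b => D) (i := j) hm.aestronglyMeasurable, hY0]
  let S : (Fin N → Fin b → Z) → ℝ := ∑ i, fun ζ => B (ζ i)
  have hevS : ∀ i : Fin N, MemLp (fun ζ : Fin N → Fin b → Z => B (ζ i)) 2
      (Measure.pi fun _ => Measure.pi fun _ => D) := fun i =>
    hB.comp_measurePreserving (measurePreserving_eval (fun _ : Fin N => Measure.pi fun _ => D) i)
  have hS : MemLp S 2 (Measure.pi fun _ => Measure.pi fun _ => D) :=
    memLp_finsetSum' _ fun i _ => hevS i
  have hS0 : ∫ ζ, S ζ ∂(Measure.pi fun _ => Measure.pi fun _ => D) = 0 := by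
    simp only [S, Finset.sum_apply]
    rw [integral_finsetSum _ fun i _ => (hevS i).integrable (by norm_num)]
    refine Finset.sum_eq_zero fun i _ => ?_
    rw [integral_comp_eval (μ := fun _ : Fin N => Measure.pi fun _ => D) (i := i)
      hB.aestronglyMeasurable, hB0]
  have hSv : ∫ ζ, S ζ ^ 2 ∂(Measure.pi fun _ => Measure.pi fun _ => D) ≤ N * (b * (8 * σ ^ 2)) := by
    have e := variance_of_integral_eq_zero hS.aestronglyMeasurable.aemeasurable hS0
    have := variance_sum_pi (μ := fun _ : Fin N => Measure.pi fun _ : Fin b => D)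
      (X := fun _ => B) (fun _ => hB)
    rw [← e, this]
    simpa using mul_le_mul_of_nonneg_left hBv (Nat.cast_nonneg N)
  -- The cross term is linear in the centered sum `S` and integrates to zero; the last term is
  -- governed by additivity of the variance.
  have e : ∀ ζ : Fin N → Fin b → Z, (A + ∑ i, batchNoise D f k x (ζ i)) ^ 2
      = A ^ 2 + 2 * A / b * S ζ + 1 / (b : ℝ) ^ 2 * S ζ ^ 2 := by
    intro ζ
    have : ∑ i, batchNoise D f k x (ζ i) = (1 / (b : ℝ)) * S ζ := by
      simp only [S, B, batchNoise, Finset.sum_apply, ← Finset.mul_sum]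
    rw [this]
    ring
  have hSi : Integrable S (Measure.pi fun _ => Measure.pi fun _ => D) :=
    hS.integrable (by norm_num)
  have i1 : Integrable (fun ζ => A ^ 2 + 2 * A / b * S ζ)
      (Measure.pi fun _ => Measure.pi fun _ => D) :=
    (integrable_const _).add (hSi.const_mul _)
  have i2 := hS.integrable_sq.const_mul (1 / (b : ℝ) ^ 2)
  rw [← ENNReal.ofReal_add (by positivity) (by positivity),
    ← ofReal_integral_eq_lintegral_ofReal _ (Filter.Eventually.of_forall fun _ => sq_nonneg _)]
  · apply ENNReal.ofReal_le_ofReal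
    simp_rw [e]
    rw [integral_add i1 i2, integral_add (integrable_const _) (hSi.const_mul _),
      integral_const_mul, integral_const_mul, hS0, integral_const, probReal_univ, one_smul]
    have : 1 / (b : ℝ) ^ 2 * ∫ ζ, S ζ ^ 2 ∂(Measure.pi fun _ => Measure.pi fun _ => D)
        ≤ 1 / (b : ℝ) ^ 2 * (N * (b * (8 * σ ^ 2))) := by gcongr
    have e2 : 1 / (b : ℝ) ^ 2 * (N * (b * (8 * σ ^ 2))) = 8 * N * σ ^ 2 / b := by
      field_simp
    linarith
  · simp_rw [e]
    exact i1.add i2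

end Noise

/-- Finitely many variables with bounded exponential moments have a common integrable envelope. -/
theorem exists_envelope {Ω ι : Type*} [MeasurableSpace Ω] {P : Measure Ω}
    [IsProbabilityMeasure P] [Fintype ι] {ξ : ι → Ω → ℝ} {l v c : ℝ} (hl : 0 < l)
    (hcard : 2 * (Fintype.card ι : ℝ) ≤ Real.exp c)
    (h1 : ∀ i, Integrable (fun ω => Real.exp (l * ξ i ω)) P)
    (h2 : ∀ i, Integrable (fun ω => Real.exp (-l * ξ i ω)) P)
    (h3 : ∀ i, ∫ ω, Real.exp (l * ξ i ω) ∂P ≤ Real.exp v)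
    (h4 : ∀ i, ∫ ω, Real.exp (-l * ξ i ω) ∂P ≤ Real.exp v) :
    ∃ Ξ : Ω → ℝ, Integrable Ξ P ∧ (∀ i ω, |ξ i ω| ≤ Ξ ω) ∧ ∫ ω, Ξ ω ∂P ≤ (c + v) / l := by
  have h12 : ∀ i, Integrable (fun ω => Real.exp (l * ξ i ω) + Real.exp (-l * ξ i ω)) P :=
    fun i => (h1 i).add (h2 i)
  have hsum : Integrable (fun ω => ∑ i, (Real.exp (l * ξ i ω) + Real.exp (-l * ξ i ω))) P :=
    integrable_finsetSum _ fun i _ => h12 i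
  -- The envelope is the tangent bound $y+1\le e^y$ at $y=l|\xi_i|-(c+v)$, with $e^{l|\xi_i|}$
  -- enlarged to the sum of all exponentials. The sum has mean at most $e^{c+v}$, so the mean of the
  -- envelope is at most $(c+v)/l$.
  refine ⟨fun ω => (1 / l) * ((c + v - 1) + Real.exp (-(c + v)) *
    ∑ i, (Real.exp (l * ξ i ω) + Real.exp (-l * ξ i ω))),
    ((integrable_const _).add (hsum.const_mul _)).const_mul _, ?_, ?_⟩
  · intro i ω
    have hle : Real.exp (l * ξ i ω) + Real.exp (-l * ξ i ω)
        ≤ ∑ i, (Real.exp (l * ξ i ω) + Real.exp (-l * ξ i ω)) :=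
      Finset.single_le_sum (f := fun i => Real.exp (l * ξ i ω) + Real.exp (-l * ξ i ω))
        (fun i _ => by positivity) (Finset.mem_univ i)
    have hexp : Real.exp (l * |ξ i ω|) ≤ Real.exp (l * ξ i ω) + Real.exp (-l * ξ i ω) := by
      rcases abs_cases (ξ i ω) with ⟨h, _⟩ | ⟨h, _⟩
      · rw [h]; linarith [Real.exp_pos (-l * ξ i ω)]
      · rw [h, mul_neg, ← neg_mul]; linarith [Real.exp_pos (l * ξ i ω)]
    have h5 : l * |ξ i ω| - (c + v) + 1 ≤ Real.exp (-(c + v)) * Real.exp (l * |ξ i ω|) := by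
      rw [← Real.exp_add, neg_add_eq_sub]
      exact Real.add_one_le_exp _
    have h6 := mul_le_mul_of_nonneg_left (hexp.trans hle) (Real.exp_pos (-(c + v))).le
    dsimp only
    rw [one_div, inv_mul_eq_div, le_div_iff₀ hl]
    linarith
  · rw [integral_const_mul, integral_add (integrable_const _) (hsum.const_mul _), integral_const,
      probReal_univ, one_smul, integral_const_mul, integral_finsetSum _ fun i _ => h12 i]
    have h5 : ∑ i, ∫ ω, (Real.exp (l * ξ i ω) + Real.exp (-l * ξ i ω)) ∂P
        ≤ Real.exp c * Real.exp v := by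
      calc _ ≤ ∑ _i : ι, 2 * Real.exp v := by
            refine Finset.sum_le_sum fun i _ => ?_
            rw [integral_add (h1 i) (h2 i)]
            linarith [h3 i, h4 i]
        _ = 2 * (Fintype.card ι : ℝ) * Real.exp v := by simp; ring
        _ ≤ _ := by gcongr
    have h6 : Real.exp (-(c + v)) * (Real.exp c * Real.exp v) = 1 := by
      rw [← Real.exp_add, ← Real.exp_add]; simp
    have h7 := mul_le_mul_of_nonneg_left h5 (Real.exp_pos (-(c + v))).le
    rw [one_div, inv_mul_eq_div]
    exact div_le_div_of_nonneg_right (by linarith) hl.le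

theorem integrable_of_lintegral_ofReal_le {Ω : Type*} [MeasurableSpace Ω] {P : Measure Ω}
    {g : Ω → ℝ} (hg : Measurable g) (hg0 : ∀ ω, 0 ≤ g ω) {c : ℝ} (hc : 0 ≤ c)
    (h : ∫⁻ ω, ENNReal.ofReal (g ω) ∂P ≤ ENNReal.ofReal c) :
    Integrable g P ∧ ∫ ω, g ω ∂P ≤ c := by
  refine ⟨⟨hg.aestronglyMeasurable, ?_⟩, ?_⟩
  · rw [hasFiniteIntegral_iff_ofReal (Filter.Eventually.of_forall hg0)]
    exact h.trans_lt ENNReal.ofReal_lt_top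
  · rw [integral_eq_lintegral_of_nonneg_ae (Filter.Eventually.of_forall hg0)
      hg.aestronglyMeasurable]
    exact ENNReal.toReal_le_of_le_ofReal hc h

/-! ### Noise along a run -/

theorem IsRun.measurable_iterate {Ω Z : Type*} [mΩ : MeasurableSpace Ω] {ℱ : Filtration ℕ mΩ}
    {d N b m H : ℕ} {f : Vec d → Z → ℝ} {X : Set (Vec d)} {x₁ : Vec d} {γ α₁ α₂ : ℝ}
    {W : ℕ → Fin N → Ω → Bool} {z : ℕ → Fin N → Fin b → Ω → Z}
    {g gh : ℕ → Fin N → Ω → Vec d} {gg x : ℕ → Ω → Vec d}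
    (hr : IsRun ℱ f X x₁ γ α₁ α₂ m H W z g gh gg x) {t : ℕ}
    (ht : t ≤ H) : Measurable[ℱ t] (x (t + 1)) := by
  rcases Nat.eq_zero_or_pos t with rfl | h
  · have : x (0 + 1) = fun _ => x₁ := funext hr.init
    rw [this]
    exact measurable_const
  · exact hr.iterate_adapted t h ht

theorem IsRun.iterate_mem {Ω Z : Type*} [mΩ : MeasurableSpace Ω] {ℱ : Filtration ℕ mΩ}
    {d N b m H : ℕ} {f : Vec d → Z → ℝ} {X : Set (Vec d)} {x₁ : Vec d} {γ α₁ α₂ : ℝ}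
    {W : ℕ → Fin N → Ω → Bool} {z : ℕ → Fin N → Fin b → Ω → Z}
    {g gh : ℕ → Fin N → Ω → Vec d} {gg x : ℕ → Ω → Vec d}
    (hr : IsRun ℱ f X x₁ γ α₁ α₂ m H W z g gh gg x) (hx₁ : x₁ ∈ X)
    {t : ℕ} (ht : t ≤ H) (ω : Ω) : x (t + 1) ω ∈ X := by
  rcases Nat.eq_zero_or_pos t with rfl | h
  · rw [hr.init ω]; exact hx₁
  · exact (hr.update t h ht ω).1

section Run

variable {Ω Z : Type*} [mΩ : MeasurableSpace Ω] [MeasurableSpace Z] {P : Measure Ω}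
  {ℱ : Filtration ℕ mΩ} {D : Measure Z}
  {d N b m H : ℕ} {f : Vec d → Z → ℝ} {X : Set (Vec d)} {x₁ : Vec d}
  {γ α₁ α₂ pb pt σ a : ℝ} {W : ℕ → Fin N → Ω → Bool} {z : ℕ → Fin N → Fin b → Ω → Z}
  {g gh : ℕ → Fin N → Ω → Vec d} {gg x : ℕ → Ω → Vec d}

theorem measurable_batchNoise_iterate (he : IsEnvironment P ℱ D pb pt H W z)
    (hr : IsRun ℱ f X x₁ γ α₁ α₂ m H W z g gh gg x) (hf : ∀ x, Measurable (f x))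
    (hd : ∀ z, Differentiable ℝ fun y => f y z) {t : ℕ} (ht : t < H) (i : Fin N) (k : Fin d) :
    Measurable[ℱ (t + 1)]
      fun ω => batchNoise D f k (x (t + 1) ω) (fun j => z (t + 1) i j ω) := by
  exact measurable_batchNoise_comp hf hd
    ((hr.measurable_iterate ht.le).mono (ℱ.mono (Nat.le_succ t)) le_rfl)
    fun j => he.sample_adapted (t + 1) (by omega) ht i j

variable [IsProbabilityMeasure P] [IsProbabilityMeasure D]

theorem integral_exp_batchNoise_iterate_le (he : IsEnvironment P ℱ D pb pt H W z)
    (hr : IsRun ℱ f X x₁ γ α₁ α₂ m H W z g gh gg x) (hf : ∀ x, Measurable (f x))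
    (hd : ∀ z, Differentiable ℝ fun y => f y z) (hx₁ : x₁ ∈ X) (hb : 1 ≤ b)
    (hsg : ∀ k : Fin d, ∀ x ∈ X, IsSubGamma D (sampleNoise D f k x) σ a)
    {t : ℕ} (ht : t < H) (i : Fin N) (k : Fin d) {l : ℝ} (hl : a * |l| ≤ b / 2) :
    Integrable (fun ω => Real.exp
        (l * batchNoise D f k (x (t + 1) ω) (fun j => z (t + 1) i j ω))) P ∧
      ∫ ω, Real.exp (l * batchNoise D f k (x (t + 1) ω) (fun j => z (t + 1) i j ω)) ∂P
        ≤ Real.exp (l ^ 2 * σ ^ 2 / b) := by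
  have hm : Measurable fun ω => batchNoise D f k (x (t + 1) ω) (fun j => z (t + 1) i j ω) :=
    (measurable_batchNoise_iterate he hr hf hd ht i k).mono (ℱ.le _) le_rfl
  refine integrable_of_lintegral_ofReal_le (hm.const_mul l).exp (fun _ => (Real.exp_pos _).le)
    (Real.exp_pos _).le ?_
  have hφ : Measurable fun q : Vec d × (Fin N → Fin b → Z) =>
      ENNReal.ofReal (Real.exp (l * batchNoise D f k q.1 (q.2 i))) := by
    have h1 : Measurable fun q : Vec d × (Fin N → Fin b → Z) => (q.1, q.2 i) := by fun_prop
    exact (((measurable_batchNoise hf hd).comp h1).const_mul l).exp.ennreal_ofReal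
  rw [he.lintegral_fresh ht (hr.measurable_iterate ht.le) hφ]
  calc _ ≤ ∫⁻ _ω, ENNReal.ofReal (Real.exp (l ^ 2 * σ ^ 2 / b)) ∂P :=
        lintegral_mono fun ω =>
          lintegral_exp_batchNoise_le hb (hsg k _ (hr.iterate_mem hx₁ ht.le ω)) hl i
    _ = _ := by simp

/-- Orthogonality of martingale increments: the earlier noise and the current iterate are known
before the new samples are drawn, so each iteration only adds its own variance, however the
adversary steers the iterates. -/
theorem lintegral_sum_batchNoise_sq_le (he : IsEnvironment P ℱ D pb pt H W z)
    (hr : IsRun ℱ f X x₁ γ α₁ α₂ m H W z g gh gg x) (hf : ∀ x, Measurable (f x))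
    (hd : ∀ z, Differentiable ℝ fun y => f y z) (hx₁ : x₁ ∈ X) (hb : 1 ≤ b) (ha : 0 ≤ a)
    (hσ : 0 ≤ σ) (hsg : ∀ k : Fin d, ∀ x ∈ X, IsSubGamma D (sampleNoise D f k x) σ a)
    (k : Fin d) (t n : ℕ) (ht : t + n ≤ H) :
    ∫⁻ ω, ENNReal.ofReal ((∑ r ∈ Finset.range n, ∑ i,
        batchNoise D f k (x (t + r + 1) ω) (fun j => z (t + r + 1) i j ω)) ^ 2) ∂P
      ≤ ENNReal.ofReal (n * (8 * N * σ ^ 2 / b)) := by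
  induction n with
  | zero => simp
  | succ n ih =>
    have hpast : Measurable[ℱ (t + n)] fun ω => ∑ r ∈ Finset.range n, ∑ i,
        batchNoise D f k (x (t + r + 1) ω) (fun j => z (t + r + 1) i j ω) :=
      measurable_sum_range_sum fun r hr' i =>
        (measurable_batchNoise_iterate he hr hf hd (by omega) i k).mono
          (ℱ.mono (by omega)) le_rfl
    have hU := hpast.prodMk (hr.measurable_iterate (t := t + n) (by omega))
    have hφ : Measurable fun q : (ℝ × Vec d) × (Fin N → Fin b → Z) =>
        ENNReal.ofReal ((q.1.1 + ∑ i, batchNoise D f k q.1.2 (q.2 i)) ^ 2) := by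
      refine Measurable.ennreal_ofReal (Measurable.pow_const (Measurable.add (by fun_prop)
        (Finset.measurable_sum _ fun i _ => ?_)) 2)
      have h1 : Measurable fun q : (ℝ × Vec d) × (Fin N → Fin b → Z) => (q.1.2, q.2 i) := by
        fun_prop
      have h2 := Measurable.comp (measurable_batchNoise (D := D) (k := k) hf hd) h1
      exact h2
    simp_rw [Finset.sum_range_succ]
    have h1 := he.lintegral_fresh (t := t + n) (by omega) hU hφ
    dsimp only at h1
    rw [h1]
    have hms : ∀ x, Measurable (sampleNoise D f k x) := fun x =>
      (measurable_sampleNoise hf hd).comp measurable_prodMk_left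
    calc _ ≤ ∫⁻ ω, (ENNReal.ofReal ((∑ r ∈ Finset.range n, ∑ i,
            batchNoise D f k (x (t + r + 1) ω) (fun j => z (t + r + 1) i j ω)) ^ 2)
            + ENNReal.ofReal (8 * N * σ ^ 2 / b)) ∂P :=
          lintegral_mono fun ω => lintegral_add_sum_batchNoise_sq_le hb ha hσ (hms _)
            (hsg k _ (hr.iterate_mem hx₁ (by omega) ω)) _
      _ ≤ ENNReal.ofReal (n * (8 * N * σ ^ 2 / b)) + ENNReal.ofReal (8 * N * σ ^ 2 / b) := by
          rw [lintegral_add_right _ measurable_const]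
          simp only [lintegral_const, measure_univ, mul_one]
          gcongr
          exact ih (by omega)
      _ = _ := by
          rw [← ENNReal.ofReal_add (by positivity) (by positivity)]
          push_cast
          congr 1
          ring

theorem exists_maxNoise_envelope (he : IsEnvironment P ℱ D pb pt H W z)
    (hr : IsRun ℱ f X x₁ γ α₁ α₂ m H W z g gh gg x) (hf : ∀ x, Measurable (f x))
    (hd : ∀ z, Differentiable ℝ fun y => f y z) (hx₁ : x₁ ∈ X) (hb : 1 ≤ b) (ha : 0 ≤ a)
    (hσ : 0 < σ) (hsg : ∀ k : Fin d, ∀ x ∈ X, IsSubGamma D (sampleNoise D f k x) σ a)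
    (hN : 1 ≤ N) (hm : 1 ≤ m) (hdim : 1 ≤ d) {t : ℕ} (hmt : m ≤ t) (htH : t ≤ H) :
    ∃ Ξ : Ω → ℝ, Integrable Ξ P ∧
      (∀ ω i (τ : Fin m) k, |batchNoise D f k (x (t - τ) ω) (fun j => z (t - τ) i j ω)| ≤ Ξ ω) ∧
      ∫ ω, Ξ ω ∂P ≤ 2 * (σ * √(Real.log (4 * N * m * d)) / √(b : ℝ)
        + a * Real.log (4 * N * m * d) / b) := by
  have hb0 : (0 : ℝ) < b := by exact_mod_cast hb
  have hcard : (1 : ℝ) ≤ N * m * d := by exact_mod_cast Nat.mul_pos (Nat.mul_pos hN hm) hdim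
  set c := Real.log (4 * N * m * d)
  have hc : 0 < c := Real.log_pos (by linarith)
  have hexpc : Real.exp c = 4 * N * m * d := Real.exp_log (by linarith)
  set s := σ / √(b : ℝ)
  have hs : 0 < s := by positivity
  have hs2 : s ^ 2 = σ ^ 2 / b := by rw [div_pow, Real.sq_sqrt hb0.le]
  -- With $l=1/q$, the first summand of $q$ gives $al\le b/2$. The second balances the two error
  -- terms: $c/l=2ac/b+s\sqrt c$ and $ls^2\le s\sqrt c$. As $s>0$, this also works for $a=0$.
  set q := 2 * (a / b) + s / √c
  have hq : 0 < q := by positivity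
  set l := 1 / q
  have hl : 0 < l := by positivity
  have hlq : l * q = 1 := by simp only [l]; field_simp
  have hal : a * |l| ≤ b / 2 := by
    rw [abs_of_pos hl]
    have h1 : l * (2 * (a / b)) ≤ 1 := by
      rw [← hlq]
      gcongr
      exact le_add_of_nonneg_right (by positivity)
    have h2 : a * l = l * (2 * (a / b)) * (b / 2) := by field_simp
    rw [h2]
    exact mul_le_of_le_one_left (by positivity) h1
  have hls : l * s ^ 2 ≤ s * √c := by
    have h1 : l * (s / √c) ≤ 1 := by
      rw [← hlq]
      gcongr
      exact le_add_of_nonneg_left (by positivity)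
    have h2 : l * s ^ 2 = l * (s / √c) * (s * √c) := by
      field_simp
    rw [h2]
    exact mul_le_of_le_one_left (by positivity) h1
  have hidx : ∀ τ : Fin m, ∃ u, t - (τ : ℕ) = u + 1 ∧ u < H := fun τ =>
    ⟨t - τ - 1, by omega, by omega⟩
  obtain ⟨Ξ, h1, h2, h3⟩ := exists_envelope (P := P)
    (ξ := fun (q : Fin N × Fin m × Fin d) ω =>
      batchNoise D f q.2.2 (x (t - q.2.1) ω) (fun j => z (t - q.2.1) q.1 j ω))
    (l := l) (v := l ^ 2 * σ ^ 2 / b) (c := c) hl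
    (by
      rw [hexpc]
      simp only [Fintype.card_prod, Fintype.card_fin]
      push_cast
      linarith)
    (fun q => by
      obtain ⟨u, hu, huH⟩ := hidx q.2.1
      rw [hu]
      exact (integral_exp_batchNoise_iterate_le he hr hf hd hx₁ hb hsg huH q.1 q.2.2 hal).1)
    (fun q => by
      obtain ⟨u, hu, huH⟩ := hidx q.2.1
      rw [hu]
      exact (integral_exp_batchNoise_iterate_le he hr hf hd hx₁ hb hsg huH q.1 q.2.2
        (l := -l) (by rwa [abs_neg])).1)
    (fun q => by
      obtain ⟨u, hu, huH⟩ := hidx q.2.1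
      rw [hu]
      exact (integral_exp_batchNoise_iterate_le he hr hf hd hx₁ hb hsg huH q.1 q.2.2 hal).2)
    (fun q => by
      obtain ⟨u, hu, huH⟩ := hidx q.2.1
      rw [hu, ← neg_sq l]
      exact (integral_exp_batchNoise_iterate_le he hr hf hd hx₁ hb hsg huH q.1 q.2.2
        (l := -l) (by rwa [abs_neg])).2)
  refine ⟨Ξ, h1, fun ω i τ k => h2 (i, τ, k) ω, h3.trans ?_⟩
  have h4 : (c + l ^ 2 * σ ^ 2 / b) / l = c * q + l * s ^ 2 := by
    rw [hs2]
    simp only [l]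
    field_simp
  have h5 : c * q = 2 * (a * c / b) + s * √c := by
    have : c * (s / √c) = s * √c := by
      rw [mul_div_assoc', div_eq_iff (by positivity), mul_assoc, Real.mul_self_sqrt hc.le, mul_comm]
    simp only [q]
    rw [mul_add, this]
    ring
  have h6 : σ * √c / √(b : ℝ) = s * √c := by simp only [s]; ring
  rw [h4, h5, h6]
  linarith

theorem exists_meanNoise_envelope (he : IsEnvironment P ℱ D pb pt H W z)
    (hr : IsRun ℱ f X x₁ γ α₁ α₂ m H W z g gh gg x) (hf : ∀ x, Measurable (f x))
    (hd : ∀ z, Differentiable ℝ fun y => f y z) (hx₁ : x₁ ∈ X) (hb : 1 ≤ b) (ha : 0 ≤ a)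
    (hσ : 0 < σ) (hsg : ∀ k : Fin d, ∀ x ∈ X, IsSubGamma D (sampleNoise D f k x) σ a)
    (hN : 1 ≤ N) (hm : 1 ≤ m) (hdim : 1 ≤ d) {t : ℕ} (hmt : m ≤ t) (htH : t ≤ H) :
    ∃ Q : Ω → ℝ, Integrable Q P ∧
      (∀ ω, ‖(WithLp.toLp 2 fun k => (1 / (N : ℝ)) * ∑ i, (1 / (m : ℝ)) * ∑ τ : Fin m,
        batchNoise D f k (x (t - τ) ω) (fun j => z (t - τ) i j ω) : Vec d)‖ ≤ Q ω) ∧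
      ∫ ω, Q ω ∂P ≤ 5 * (σ * √(d : ℝ) / √(m * N * b : ℝ)) := by
  have hb0 : (0 : ℝ) < b := by exact_mod_cast hb
  have hN0 : (0 : ℝ) < N := by exact_mod_cast hN
  have hm0 : (0 : ℝ) < m := by exact_mod_cast hm
  have hd0 : (0 : ℝ) < d := by exact_mod_cast hdim
  set q := σ * √(d : ℝ) / √(m * N * b : ℝ)
  have hq : 0 < q := by positivity
  have hq2 : q ^ 2 = d * (σ ^ 2 / (m * N * b)) := by
    rw [div_pow, mul_pow, Real.sq_sqrt hd0.le, Real.sq_sqrt (by positivity)]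
    ring
  obtain ⟨u, rfl⟩ : ∃ u, t = u + m := ⟨t - m, by omega⟩
  let S : Fin d → Ω → ℝ := fun k ω => ∑ r ∈ Finset.range m, ∑ i,
        batchNoise D f k (x (u + r + 1) ω) (fun j => z (u + r + 1) i j ω)
  have hSm : ∀ k, Measurable (S k) := fun k =>
    measurable_sum_range_sum fun r hr' i =>
        (measurable_batchNoise_iterate he hr hf hd (by omega) i k).mono (ℱ.le _) le_rfl
  have hS : ∀ k, Integrable (fun ω => S k ω ^ 2) P ∧
      ∫ ω, S k ω ^ 2 ∂P ≤ m * (8 * N * σ ^ 2 / b) := fun k =>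
    integrable_of_lintegral_ofReal_le ((hSm k).pow_const 2) (fun _ => sq_nonneg _) (by positivity)
      (lintegral_sum_batchNoise_sq_le he hr hf hd hx₁ hb ha hσ.le hsg k u m htH)
  have hmean : ∀ k ω, (1 / (N : ℝ)) * ∑ i, (1 / (m : ℝ)) * ∑ τ : Fin m,
        batchNoise D f k (x (u + m - τ) ω) (fun j => z (u + m - τ) i j ω)
      = 1 / (m * N : ℝ) * S k ω := by
    intro k ω
    rw [← Finset.mul_sum, Finset.sum_comm]
    rw [Fin.sum_univ_eq_sum_range (fun τ => ∑ i,
      batchNoise D f k (x (u + m - τ) ω) (fun j => z (u + m - τ) i j ω)) m,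
      ← Finset.sum_range_reflect, ← mul_assoc]
    congr 1
    · field_simp
    · refine Finset.sum_congr rfl fun r hr' => ?_
      have := Finset.mem_range.1 hr'
      have e : u + m - (m - 1 - r) = u + r + 1 := by omega
      rw [e]
  have hsum : Integrable (fun ω => ∑ k, S k ω ^ 2) P := integrable_finsetSum _ fun k _ => (hS k).1
  -- This is $\|y\|\le\|y\|^2/(2q)+q/2$ with $q$ the target size. Since $\mathbb E\|y\|^2\le8q^2$,
  -- the mean is at most $4q+q/2\le5q$.
  refine ⟨fun ω => 1 / (2 * q) * (1 / (m * N : ℝ) ^ 2 * ∑ k, S k ω ^ 2) + q / 2,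
    ((hsum.const_mul _).const_mul _).add (integrable_const _), fun ω => ?_, ?_⟩
  · set y : Vec d := WithLp.toLp 2 _
    have hy : ‖y‖ ^ 2 = 1 / (m * N : ℝ) ^ 2 * ∑ k, S k ω ^ 2 := by
      rw [EuclideanSpace.norm_sq_eq, Finset.mul_sum]
      refine Finset.sum_congr rfl fun k _ => ?_
      simp only [y]
      rw [hmean, Real.norm_eq_abs, sq_abs]
      ring
    dsimp only
    rw [← hy]
    have h1 : 1 / (2 * q) * ‖y‖ ^ 2 + q / 2 = ‖y‖ + (‖y‖ - q) ^ 2 / (2 * q) := by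
      field_simp
      ring
    rw [h1]
    exact le_add_of_nonneg_right (by positivity)
  · rw [integral_add ((hsum.const_mul _).const_mul _) (integrable_const _), integral_const_mul,
      integral_const_mul, integral_const, probReal_univ, one_smul,
      integral_finsetSum _ fun k _ => (hS k).1]
    have h1 : ∑ k, ∫ ω, S k ω ^ 2 ∂P ≤ d * (m * (8 * N * σ ^ 2 / b)) := by
      refine (Finset.sum_le_card_nsmul _ _ _ fun k _ => (hS k).2).trans ?_
      simp
    have h2 : 1 / (m * N : ℝ) ^ 2 * (d * (m * (8 * N * σ ^ 2 / b))) = 8 * q ^ 2 := by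
      rw [hq2]
      field_simp
    have h3 : 1 / (2 * q) * (1 / (m * N : ℝ) ^ 2 * ∑ k, ∫ ω, S k ω ^ 2 ∂P)
        ≤ 1 / (2 * q) * (8 * q ^ 2) := by
      rw [← h2]
      gcongr
    have h4 : 1 / (2 * q) * (8 * q ^ 2) = 4 * q := by field_simp; norm_num
    linarith

end Run

/-! ### The network of Markov chains -/

theorem sum_transition (pb pt : ℝ) (s : Bool) : ∑ s', transition pb pt s s' = 1 := by
  cases s <;> simp [transition]

theorem transition_nonneg {pb pt : ℝ} (hb : 0 ≤ pb) (hb' : pb ≤ 1) (ht : 0 ≤ pt)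
    (ht' : pt ≤ 1) (s s' : Bool) : 0 ≤ transition pb pt s s' := by
  cases s <;> cases s' <;> simp [transition] <;> linarith

theorem windowTail_mem {pb pt : ℝ} (hb : 0 ≤ pb) (hb' : pb ≤ 1) (ht : 0 ≤ pt)
    (ht' : pt ≤ 1) (θ : ℝ) (n c : ℕ) (s : Bool) :
    windowTail pb pt θ n c s ∈ Set.Icc (0 : ℝ) 1 := by
  have h0 := transition_nonneg hb hb' ht ht'
  induction n generalizing c s with
  | zero => unfold windowTail; split_ifs <;> simp
  | succ n ih =>
    unfold windowTail
    refine ⟨Finset.sum_nonneg fun s' _ => mul_nonneg (h0 s s') (ih _ s').1, ?_⟩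
    rw [← sum_transition pb pt s]
    exact Finset.sum_le_sum fun s' _ => mul_le_of_le_one_right (h0 s s') (ih _ s').2

theorem agentFailure_zero (pb pt α₁ : ℝ) (m : ℕ) (s : Bool) :
    agentFailure pb pt α₁ m 0 s = windowTail pb pt (α₁ * m) m 0 s := by
  simp [agentFailure, Matrix.one_apply]

theorem agentFailure_succ (pb pt α₁ : ℝ) (m n : ℕ) (s : Bool) :
    agentFailure pb pt α₁ m (n + 1) s
      = ∑ s', transition pb pt s s' * agentFailure pb pt α₁ m n s' := by
  simp only [agentFailure, pow_succ', Matrix.mul_apply, Finset.sum_mul, Finset.mul_sum]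
  rw [Finset.sum_comm]
  simp only [mul_assoc]

theorem abs_sum_transition_mul_le {pb pt : ℝ} (hb : 0 ≤ pb) (hb' : pb ≤ 1) (ht : 0 ≤ pt)
    (ht' : pt ≤ 1) (s : Bool) {ρ : Bool → ℝ} (hρ : ∀ s', |ρ s'| ≤ 1) :
    |∑ s', transition pb pt s s' * ρ s'| ≤ 1 := by
  have h0 := transition_nonneg hb hb' ht ht' s
  refine (Finset.abs_sum_le_sum_abs _ _).trans ?_
  rw [← sum_transition pb pt s]
  refine Finset.sum_le_sum fun s' _ => ?_
  rw [abs_mul, abs_of_nonneg (h0 s')]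
  exact mul_le_of_le_one_right (h0 s') (hρ s')

theorem abs_prod_le_one {ι : Type*} [Fintype ι] {u : ι → ℝ} (h : ∀ i, |u i| ≤ 1) :
    |∏ i, u i| ≤ 1 := by
  rw [Finset.abs_prod]
  exact Finset.prod_le_one (fun i _ => abs_nonneg _) fun i _ => h i

section Chain

variable {Ω Z : Type*} [mΩ : MeasurableSpace Ω] [MeasurableSpace Z] {P : Measure Ω}
  [IsProbabilityMeasure P] {ℱ : Filtration ℕ mΩ} {D : Measure Z}
  {N b m H : ℕ} {pb pt : ℝ} {W : ℕ → Fin N → Ω → Bool} {z : ℕ → Fin N → Fin b → Ω → Z}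

/-- The Markov property tested against functions of the next state and the past: split by the value
`w` of the next state and pull the known factor `G w` out of the conditional expectation. -/
theorem IsEnvironment.integral_step (he : IsEnvironment P ℱ D pb pt H W z) {t : ℕ} (ht : 1 ≤ t)
    (htH : t < H) {G : (Fin N → Bool) → Ω → ℝ} (hG : ∀ w, Measurable[ℱ t] (G w)) {C : ℝ}
    (hC : ∀ w ω, |G w ω| ≤ C) :
    ∫ ω, G (fun i => W (t + 1) i ω) ω ∂P
      = ∫ ω, ∑ w : Fin N → Bool, (∏ i, transition pb pt (W t i ω) (w i)) * G w ω ∂P := by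
  let e : (Fin N → Bool) → Ω → ℝ := fun w =>
    Set.indicator {ω | ∀ i, W (t + 1) i ω = w i} fun _ => (1 : ℝ)
  have hset : ∀ w : Fin N → Bool, MeasurableSet {ω | ∀ i, W (t + 1) i ω = w i} := by
    intro w
    rw [Set.ofPred_forall]
    exact MeasurableSet.iInter fun i =>
      ((he.state_adapted (t + 1) (by omega) htH i).mono (ℱ.le _) le_rfl)
        (measurableSet_singleton (w i))
  have he1 : ∀ w, Integrable (e w) P := fun w => (integrable_const 1).indicator (hset w)
  have heG : ∀ w, Integrable (e w * G w) P := by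
    intro w
    refine Integrable.mono' (integrable_const C) ((he1 w).aestronglyMeasurable.mul
      ((hG w).mono (ℱ.le t) le_rfl).aestronglyMeasurable) (Filter.Eventually.of_forall fun ω => ?_)
    have h0 : |e w ω| ≤ 1 := by
      simp only [e, Set.indicator_apply]
      split_ifs <;> simp
    rw [Pi.mul_apply, Real.norm_eq_abs, abs_mul]
    exact (mul_le_of_le_one_left (abs_nonneg _) h0).trans (hC w ω)
  have key : ∀ w, P[e w * G w | ℱ t]
      =ᵐ[P] fun ω => (∏ i, transition pb pt (W t i ω) (w i)) * G w ω := by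
    intro w
    have h1 := condExp_mul_of_stronglyMeasurable_right (hG w).stronglyMeasurable (heG w) (he1 w)
    filter_upwards [h1, he.markov t ht htH w] with ω h1 h2
    rw [h1, Pi.mul_apply, h2]
  have hdec : ∀ ω, G (fun i => W (t + 1) i ω) ω = ∑ w, (e w * G w) ω := by
    intro ω
    rw [Finset.sum_eq_single fun i => W (t + 1) i ω]
    · simp [e]
    · intro w _ hw
      have : ω ∉ {ω | ∀ i, W (t + 1) i ω = w i} := fun h => hw (funext fun i => (h i).symm)
      simp [e, Set.indicator_of_notMem this]
    · simp
  simp_rw [hdec]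
  rw [integral_finsetSum _ fun w _ => heG w, integral_finsetSum]
  · refine Finset.sum_congr rfl fun w _ => ?_
    rw [← integral_condExp (ℱ.le t)]
    exact integral_congr_ae (key w)
  · intro w _
    exact (integrable_condExp (m := ℱ t) (f := e w * G w)).congr (key w)

/-- The chains move independently, so product test functions stay products: the sum over joint
states of a product is the product of the agentwise sums. -/
theorem IsEnvironment.integral_prod_step (he : IsEnvironment P ℱ D pb pt H W z) {t : ℕ}
    (ht : 1 ≤ t) (htH : t < H) {ρ : Fin N → ℕ → Bool → ℝ} (hρ : ∀ i c s, |ρ i c s| ≤ 1)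
    {c : Fin N → Ω → ℕ} (hc : ∀ i, Measurable[ℱ t] (c i)) {Y : Ω → ℝ} (hY : Measurable[ℱ t] Y)
    {C : ℝ} (hC : ∀ ω, |Y ω| ≤ C) :
    ∫ ω, Y ω * ∏ i, ρ i (c i ω) (W (t + 1) i ω) ∂P
      = ∫ ω, Y ω * ∏ i, ∑ s', transition pb pt (W t i ω) s' * ρ i (c i ω) s' ∂P := by
  have hG : ∀ w : Fin N → Bool, Measurable[ℱ t] fun ω => Y ω * ∏ i, ρ i (c i ω) (w i) := by
    intro w
    refine hY.mul (Finset.measurable_prod _ fun i _ => ?_)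
    exact (Measurable.of_discrete (f := fun n => ρ i n (w i))).comp (hc i)
  rw [he.integral_step ht htH (G := fun w ω => Y ω * ∏ i, ρ i (c i ω) (w i)) hG (C := C)]
  · refine integral_congr_ae (Filter.Eventually.of_forall fun ω => ?_)
    dsimp only
    rw [Finset.prod_univ_sum, Finset.mul_sum, Fintype.piFinset_univ]
    refine Finset.sum_congr rfl fun w _ => ?_
    rw [Finset.prod_mul_distrib]
    ring
  · intro w ω
    rw [abs_mul]
    exact (mul_le_of_le_one_right (abs_nonneg _) (abs_prod_le_one fun i => hρ i _ _)).trans (hC ω)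

/-- Iterating the one-step identity shows that the recursion of `windowTail` computes a conditional
expectation of a function of the final count. The family `τ` is abstract and may vary with the
agent, so that it can be the tail for some agents and its complement for the others. -/
theorem IsEnvironment.integral_prod_tail (hpb : 0 ≤ pb) (hpb' : pb ≤ 1) (hpt : 0 ≤ pt) (hpt' : pt ≤ 1)
    (he : IsEnvironment P ℱ D pb pt H W z)
    {τ : Fin N → ℕ → ℕ → Bool → ℝ} (hτ0 : ∀ i c s, τ i 0 c s = τ i 0 c false)
    (hτ1 : ∀ i c s, |τ i 0 c s| ≤ 1)
    (hτ : ∀ i n c s, τ i (n + 1) c s = ∑ s', transition pb pt s s' * τ i n (c + s.toNat) s')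
    (n : ℕ) {t : ℕ} (ht : 1 ≤ t) (htH : t + n ≤ H + 1) {c : Fin N → Ω → ℕ}
    (hc : ∀ i, Measurable[ℱ t] (c i)) {Y : Ω → ℝ} (hY : Measurable[ℱ t] Y)
    {C : ℝ} (hC : ∀ ω, |Y ω| ≤ C) :
    ∫ ω, Y ω * ∏ i, τ i n (c i ω) (W t i ω) ∂P
      = ∫ ω, Y ω * ∏ i, τ i 0 (c i ω + ∑ r ∈ Finset.range n, (W (t + r) i ω).toNat) false ∂P := by
  have hbound : ∀ n i c s, |τ i n c s| ≤ 1 := by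
    intro n
    induction n with
    | zero => exact hτ1
    | succ n ih =>
      intro i c s
      rw [hτ]
      exact abs_sum_transition_mul_le hpb hpb' hpt hpt' s fun s' => ih i _ s'
  induction n generalizing t c with
  | zero =>
    simp only [Finset.range_zero, Finset.sum_empty, add_zero]
    simp_rw [hτ0 _ _ (W _ _ _)]
  | succ n ih =>
    simp_rw [hτ]
    -- A window of `n` states contains `n - 1` transitions, but the recursion makes `n`. The last
    -- one has no effect, since `τ i 0` ignores the state, and so nothing beyond the horizon is
    -- used.
    rcases Nat.eq_zero_or_pos n with rfl | hn
    · simp_rw [hτ0 _ _ _, ← Finset.sum_mul, sum_transition]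
      simp
    · have hc' : ∀ i, Measurable[ℱ t] fun ω => c i ω + (W t i ω).toNat := fun i =>
        (hc i).add ((Measurable.of_discrete (f := Bool.toNat)).comp
          (he.state_adapted t ht (by omega) i))
      rw [← he.integral_prod_step ht (by omega) (ρ := fun i => τ i n) (hbound n) hc' hY hC,
        ih (t := t + 1) (by omega) (by omega)
          (fun i => (hc' i).mono (ℱ.mono (Nat.le_succ t)) le_rfl)
          (hY.mono (ℱ.mono (Nat.le_succ t)) le_rfl)]
      refine integral_congr_ae (Filter.Eventually.of_forall fun ω => ?_)
      dsimp only
      congr 1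
      refine Finset.prod_congr rfl fun i _ => ?_
      rw [Finset.sum_range_succ', add_zero]
      congr 1
      rw [add_assoc, add_comm (W t i ω).toNat]
      simp only [add_assoc, add_comm 1]

theorem IsEnvironment.integral_prod_steps (hpb : 0 ≤ pb) (hpb' : pb ≤ 1) (hpt : 0 ≤ pt) (hpt' : pt ≤ 1)
    (he : IsEnvironment P ℱ D pb pt H W z)
    {q : Fin N → ℕ → Bool → ℝ} (hq1 : ∀ i s, |q i 0 s| ≤ 1)
    (hq : ∀ i n s, q i (n + 1) s = ∑ s', transition pb pt s s' * q i n s')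
    (n : ℕ) {t : ℕ} (ht : 1 ≤ t) (htH : t + n ≤ H) {Y : Ω → ℝ} (hY : Measurable[ℱ t] Y)
    {C : ℝ} (hC : ∀ ω, |Y ω| ≤ C) :
    ∫ ω, Y ω * ∏ i, q i n (W t i ω) ∂P = ∫ ω, Y ω * ∏ i, q i 0 (W (t + n) i ω) ∂P := by
  have hbound : ∀ n i s, |q i n s| ≤ 1 := by
    intro n
    induction n with
    | zero => exact hq1
    | succ n ih =>
      intro i s
      rw [hq]
      exact abs_sum_transition_mul_le hpb hpb' hpt hpt' s fun s' => ih i s'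
  induction n generalizing t with
  | zero => rfl
  | succ n ih =>
    simp_rw [hq]
    have h := he.integral_prod_step ht (by omega) (ρ := fun i _ => q i n)
      (fun i _ s => hbound n i s) (c := fun _ _ => 0) (fun _ => measurable_const) hY hC
    rw [← h, ih (t := t + 1) (by omega) (by omega) (hY.mono (ℱ.mono (Nat.le_succ t)) le_rfl)]
    rw [add_assoc, add_comm 1]

theorem integrable_mul_comp {E : Type*} [MeasurableSpace E] [DiscreteMeasurableSpace E]
    {V : Ω → E} (hV : Measurable V) {Y : Ω → ℝ} (hY : Measurable Y) {C : ℝ}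
    (hC : ∀ ω, |Y ω| ≤ C) {h : E → ℝ} {K : ℝ} (hK : ∀ v, |h v| ≤ K) :
    Integrable (fun ω => Y ω * h (V ω)) P := by
  refine Integrable.of_bound (hY.mul ((Measurable.of_discrete (f := h)).comp hV)
    |>.aestronglyMeasurable) (C * K) (Filter.Eventually.of_forall fun ω => ?_)
  rw [Real.norm_eq_abs, abs_mul]
  exact mul_le_mul (hC ω) (hK _) (abs_nonneg _) ((abs_nonneg _).trans (hC ω))

/-- `networkFailure` is the conditional probability, given the current states, that too many
agents are Byzantine too often in a later window. -/
theorem IsEnvironment.integral_mul_failure_eq (hpb : 0 ≤ pb) (hpb' : pb ≤ 1) (hpt : 0 ≤ pt) (hpt' : pt ≤ 1)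
    (he : IsEnvironment P ℱ D pb pt H W z)
    (α₁ α₂ : ℝ) (m₀ : ℕ) {t : ℕ} (ht : 1 ≤ t) (hm : 1 ≤ m) (htH : t + m₀ + m ≤ H + 1)
    {Y : Ω → ℝ} (hY : Measurable[ℱ t] Y) {C : ℝ} (hC : ∀ ω, |Y ω| ≤ C) :
    ∫ ω, Y ω * (if α₂ * N < ((Finset.univ.filter fun i => α₁ * m <
        ((∑ r ∈ Finset.range m, (W (t + m₀ + r) i ω).toNat : ℕ) : ℝ)).card : ℝ)
        then 1 else 0) ∂P
      = ∫ ω, Y ω * networkFailure pb pt α₁ α₂ N m m₀ (fun i => W t i ω) ∂P := by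
  classical
  have hY' : Measurable Y := hY.mono (ℱ.le t) le_rfl
  have hW : Measurable fun ω (i : Fin N) => W t i ω := measurable_pi_iff.2 fun i =>
    (he.state_adapted t ht (by omega) i).mono (ℱ.le _) le_rfl
  let cnt : Ω → Fin N → ℕ := fun ω i => ∑ r ∈ Finset.range m, (W (t + m₀ + r) i ω).toNat
  have hcnt : Measurable cnt := measurable_pi_iff.2 fun i =>
    Finset.measurable_sum _ fun r hr => (Measurable.of_discrete (f := Bool.toNat)).comp
      ((he.state_adapted (t + m₀ + r) (by omega) (by have := Finset.mem_range.1 hr; omega) i).mono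
        (ℱ.le _) le_rfl)
  let bad : (Fin N → ℕ) → Finset (Fin N) := fun c =>
    Finset.univ.filter fun i => α₁ * m < ((c i : ℕ) : ℝ)
  let 𝒮 := (Finset.univ : Finset (Finset (Fin N))).filter (fun S => α₂ * N < (S.card : ℝ))
  let prob : Finset (Fin N) → (Fin N → Bool) → ℝ := fun S w =>
    (∏ i ∈ S, agentFailure pb pt α₁ m m₀ (w i)) *
      ∏ i ∈ Sᶜ, (1 - agentFailure pb pt α₁ m m₀ (w i))
  -- The event that exactly the agents in `S` fail is a product over agents, so the product
  -- identities apply, over the `m₀` lead-in steps and then over the window. The failure event is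
  -- the disjoint union of these events over the large `S`.
  have key : ∀ S : Finset (Fin N), ∫ ω, Y ω * (if bad (cnt ω) = S then 1 else 0) ∂P
      = ∫ ω, Y ω * prob S (fun i => W t i ω) ∂P := by
    intro S
    let τ : Fin N → ℕ → ℕ → Bool → ℝ := fun i n c s =>
      if i ∈ S then windowTail pb pt (α₁ * m) n c s else 1 - windowTail pb pt (α₁ * m) n c s
    let q : Fin N → ℕ → Bool → ℝ := fun i n s =>
      if i ∈ S then agentFailure pb pt α₁ m n s else 1 - agentFailure pb pt α₁ m n s
    have hq0 : ∀ i s, q i 0 s = τ i m 0 s := fun i s => by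
      simp only [q, τ, agentFailure_zero]
    have hτ1 : ∀ i n c s, |τ i n c s| ≤ 1 := by
      intro i n c s
      have h := windowTail_mem hpb hpb' hpt hpt' (α₁ * m) n c s
      simp only [τ]
      split_ifs
      · exact abs_le.2 ⟨by linarith [h.1], h.2⟩
      · exact abs_le.2 ⟨by linarith [h.2], by linarith [h.1]⟩
    have h1 := he.integral_prod_steps hpb hpb' hpt hpt' (q := q)
      (fun i s => by rw [hq0]; exact hτ1 i m 0 s)
      (fun i n s => by
        simp only [q]
        split_ifs
        · exact agentFailure_succ pb pt α₁ m n s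
        · rw [agentFailure_succ]
          simp only [mul_sub, mul_one, Finset.sum_sub_distrib, sum_transition])
      m₀ ht (by omega) hY hC
    have h2 := he.integral_prod_tail hpb hpb' hpt hpt' (τ := τ)
      (fun i c s => by simp only [τ, windowTail]) (fun i c s => hτ1 i 0 c s)
      (fun i n c s => by
        simp only [τ]
        split_ifs
        · rfl
        · simp only [mul_sub, mul_one, Finset.sum_sub_distrib, sum_transition, windowTail])
      m (t := t + m₀) (by omega) (by omega) (c := fun _ _ => 0) (fun _ => measurable_const)
      (hY.mono (ℱ.mono (Nat.le_add_right t m₀)) le_rfl) hC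
    have e1 : ∀ w : Fin N → Bool, prob S w = ∏ i, q i m₀ (w i) := by
      intro w
      rw [← Finset.prod_mul_prod_compl S]
      exact congrArg₂ (· * ·) (Finset.prod_congr rfl fun i hi => by simp only [q, hi, if_true])
        (Finset.prod_congr rfl fun i hi => by simp only [q, Finset.mem_compl.1 hi, if_false])
    have e2 : ∀ ω, (if bad (cnt ω) = S then (1 : ℝ) else 0) = ∏ i, τ i 0 (0 + cnt ω i) false := by
      intro ω
      have e3 : ∀ i, τ i 0 (0 + cnt ω i) false = if (i ∈ bad (cnt ω) ↔ i ∈ S) then 1 else 0 := by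
        intro i
        simp only [τ, windowTail, zero_add, bad, Finset.mem_filter, Finset.mem_univ, true_and]
        by_cases h3 : i ∈ S <;> by_cases h4 : α₁ * m < (cnt ω i : ℝ) <;> simp [h3, h4]
      simp_rw [e3]
      rw [Finset.prod_ite_zero]
      simp [Finset.ext_iff]
    simp_rw [e1, e2]
    rw [h1]
    simp_rw [hq0]
    exact h2.symm
  have hl : ∀ ω, (if α₂ * N < ((Finset.univ.filter fun i => α₁ * m <
        ((∑ r ∈ Finset.range m, (W (t + m₀ + r) i ω).toNat : ℕ) : ℝ)).card : ℝ)
        then (1 : ℝ) else 0) = ∑ S ∈ 𝒮, if bad (cnt ω) = S then 1 else 0 := by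
    intro ω
    rw [Finset.sum_ite_eq]
    simp only [𝒮, Finset.mem_filter, Finset.mem_univ, true_and]
    rfl
  have hr : ∀ w, networkFailure pb pt α₁ α₂ N m m₀ w = ∑ S ∈ 𝒮, prob S w := fun w => rfl
  simp_rw [hl, hr, Finset.mul_sum]
  rw [integral_finsetSum, integral_finsetSum]
  · exact Finset.sum_congr rfl fun S _ => key S
  · intro S _
    exact integrable_mul_comp hW hY' hC (K := ∑ w, |prob S w|) fun w =>
      Finset.single_le_sum (f := fun w => |prob S w|) (fun _ _ => abs_nonneg _)
        (Finset.mem_univ w)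
  · intro S _
    exact integrable_mul_comp hcnt hY' hC (h := fun c => if bad c = S then 1 else 0) (K := 1)
      fun c => by split_ifs <;> simp

theorem IsEnvironment.integral_mul_failure_le (hpb : 0 ≤ pb) (hpb' : pb ≤ 1) (hpt : 0 ≤ pt) (hpt' : pt ≤ 1)
    (he : IsEnvironment P ℱ D pb pt H W z)
    {α₁ α₂ : ℝ} {m₀ : ℕ} {t : ℕ} (ht : 1 ≤ t) (hm : 1 ≤ m) (htH : t + m₀ + m ≤ H + 1)
    {p : ℝ} (hp : worstFailure pb pt α₁ α₂ N m m₀ ≤ p)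
    {Y : Ω → ℝ} (hY : Measurable[ℱ t] Y) (hY0 : ∀ ω, 0 ≤ Y ω) {C : ℝ} (hC : ∀ ω, Y ω ≤ C) :
    ∫ ω, Y ω * (if α₂ * N < ((Finset.univ.filter fun i => α₁ * m <
        ((∑ r ∈ Finset.range m, (W (t + m₀ + r) i ω).toNat : ℕ) : ℝ)).card : ℝ)
        then 1 else 0) ∂P
      ≤ p * ∫ ω, Y ω ∂P := by
  have hC' : ∀ ω, |Y ω| ≤ C := fun ω => by rw [abs_of_nonneg (hY0 ω)]; exact hC ω
  have hY' : Measurable Y := hY.mono (ℱ.le t) le_rfl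
  have hW : Measurable fun ω (i : Fin N) => W t i ω := measurable_pi_iff.2 fun i =>
    (he.state_adapted t ht (by omega) i).mono (ℱ.le _) le_rfl
  rw [he.integral_mul_failure_eq hpb hpb' hpt hpt' α₁ α₂ m₀ ht hm htH hY hC',
    ← integral_const_mul]
  refine integral_mono ?_ ?_ fun ω => ?_
  · exact integrable_mul_comp hW hY' hC' (h := networkFailure pb pt α₁ α₂ N m m₀)
      (K := ∑ w, |networkFailure pb pt α₁ α₂ N m m₀ w|) fun w =>
      Finset.single_le_sum (f := fun w => |networkFailure pb pt α₁ α₂ N m m₀ w|)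
        (fun _ _ => abs_nonneg _) (Finset.mem_univ w)
  · exact (Integrable.of_bound hY'.aestronglyMeasurable C
      (Filter.Eventually.of_forall hC')).const_mul p
  · dsimp only
    rw [mul_comm]
    exact mul_le_mul_of_nonneg_right
      ((le_ciSup (Finite.bddAbove_range _) _).trans hp) (hY0 ω)

end Chain

/-! ### One iteration of a run -/

section Run

variable {Ω Z : Type*} [mΩ : MeasurableSpace Ω] {ℱ : Filtration ℕ mΩ}
  {d N b m H : ℕ} {f : Vec d → Z → ℝ} {X : Set (Vec d)} {x₁ : Vec d}
  {γ α₁ α₂ : ℝ} {W : ℕ → Fin N → Ω → Bool} {z : ℕ → Fin N → Fin b → Ω → Z}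
  {g gh : ℕ → Fin N → Ω → Vec d} {gg x : ℕ → Ω → Vec d}

theorem IsRun.norm_iterate_sub_le (hr : IsRun ℱ f X x₁ γ α₁ α₂ m H W z g gh gg x)
    (hX : Convex ℝ X) (hx₁ : x₁ ∈ X) (hγ : 0 ≤ γ) {s : ℕ} (hs : 1 ≤ s) (n : ℕ)
    (hn : s + n ≤ H + 1) (ω : Ω) : ‖x (s + n) ω - x s ω‖ ≤ γ * n := by
  induction n with
  | zero => simp
  | succ n ih =>
    have h1 := ih (by omega)
    obtain ⟨u, hu⟩ : ∃ u, s + n = u + 1 := ⟨s + n - 1, by omega⟩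
    have h2 := (hr.update (s + n) (by omega) (by omega) ω).norm_step_le hX hγ
      (by rw [hu]; exact hr.iterate_mem hx₁ (by omega) ω)
    have h3 := norm_sub_le_norm_sub_add_norm_sub (x (s + n + 1) ω) (x (s + n) ω) (x s ω)
    push_cast
    rw [← add_assoc]
    linarith

variable [MeasurableSpace Z] {D : Measure Z} {L : ℝ}

theorem IsRun.norm_aggregate_sub_gradient_le (hr : IsRun ℱ f X x₁ γ α₁ α₂ m H W z g gh gg x)
    (hX : Convex ℝ X) (hx₁ : x₁ ∈ X) (hγ : 0 ≤ γ) (hL : 0 ≤ L)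
    (hd : ∀ z, Differentiable ℝ fun y => f y z)
    (hlip : ∀ x ∈ X, ∀ y ∈ X,
      ‖gradient (risk D f) x - gradient (risk D f) y‖ ≤ L * ‖x - y‖)
    (hdim : 1 ≤ d) (hN : 1 ≤ N) (hm : 1 ≤ m) (hb : 1 ≤ b)
    (h1 : 0 ≤ α₁) (h1' : α₁ < 1 / 2) (h2 : 0 ≤ α₂) (h2' : α₂ < 1 / 2)
    {t : ℕ} (hmt : m ≤ t) (htH : t ≤ H) {ω : Ω} {Ξ Q : ℝ}
    (hΞ : ∀ i (τ : Fin m) k, |batchNoise D f k (x (t - τ) ω) (fun j => z (t - τ) i j ω)| ≤ Ξ)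
    (hQ : ‖(WithLp.toLp 2 fun k => (1 / (N : ℝ)) * ∑ i, (1 / (m : ℝ)) * ∑ τ : Fin m,
        batchNoise D f k (x (t - τ) ω) (fun j => z (t - τ) i j ω) : Vec d)‖ ≤ Q)
    (hgood : ((Finset.univ.filter fun i => α₁ * m <
      ((Finset.univ.filter fun τ : Fin m => W (t - τ) i ω = true).card : ℝ)).card : ℝ)
        ≤ α₂ * N) :
    ‖gg t ω - gradient (risk D f) (x t ω)‖
      ≤ 9 / 4 * (Calpha d α₂ + Calpha d α₁ * (1 + Calpha d α₂)) * (Ξ + L * (γ * (m - 1)))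
        + Q + L * (γ * (m - 1)) := by
  have hm0 : (0 : ℝ) < m := by exact_mod_cast hm
  have hN0 : (0 : ℝ) < N := by exact_mod_cast hN
  have hm1 : (0 : ℝ) ≤ (m : ℝ) - 1 := by
    rw [sub_nonneg]; exact_mod_cast hm
  set F' := gradient (risk D f)
  set δ := L * (γ * ((m : ℝ) - 1))
  have hδ : 0 ≤ δ := by positivity
  have hΞ0 : 0 ≤ Ξ := (abs_nonneg _).trans (hΞ ⟨0, hN⟩ ⟨0, hm⟩ ⟨0, hdim⟩)
  have hmem : ∀ s, 1 ≤ s → s ≤ H → x s ω ∈ X := by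
    intro s hs hsH
    obtain ⟨u, rfl⟩ : ∃ u, s = u + 1 := ⟨s - 1, by omega⟩
    exact hr.iterate_mem hx₁ (by omega) ω
  have hdrift : ∀ τ : Fin m, ‖F' (x (t - τ) ω) - F' (x t ω)‖ ≤ δ := by
    intro τ
    refine (hlip _ (hmem _ (by omega) (by omega)) _ (hmem _ (by omega) htH)).trans ?_
    have h3 := hr.norm_iterate_sub_le hX hx₁ hγ (s := t - τ) (by omega) τ (by omega) ω
    rw [Nat.sub_add_cancel (by omega), norm_sub_rev] at h3
    have h4 : ((τ : ℕ) : ℝ) ≤ (m : ℝ) - 1 := by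
      rw [le_sub_iff_add_le]
      exact_mod_cast τ.2
    refine mul_le_mul_of_nonneg_left (h3.trans ?_) hL
    gcongr
  set y : Vec d := WithLp.toLp 2 fun k => (1 / (N : ℝ)) * ∑ i, (1 / (m : ℝ)) * ∑ τ : Fin m,
        batchNoise D f k (x (t - τ) ω) (fun j => z (t - τ) i j ω)
  set M : Vec d := (1 / (m : ℝ)) • ∑ τ : Fin m, (F' (x (t - τ) ω) - F' (x t ω))
  have hM : ‖M‖ ≤ δ := by
    rw [norm_smul, Real.norm_of_nonneg (by positivity)]
    calc _ ≤ (1 / (m : ℝ)) * (m * δ) := by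
          gcongr
          refine (norm_sum_le _ _).trans ?_
          refine (Finset.sum_le_card_nsmul _ _ _ fun τ _ => hdrift τ).trans ?_
          simp
      _ = δ := by field_simp
  set A₁ := 6 * α₁ / (1 - α₁)
  set A₂ := 6 * α₂ / (1 - α₂)
  have hA₁ : 0 ≤ A₁ := div_nonneg (by linarith) (by linarith)
  have hA₂ : 0 ≤ A₂ := div_nonneg (by linarith) (by linarith)
  -- The reference value is the gradient an agent would have sent if honest, population gradient
  -- plus the noise of the samples it drew. The mean of all references is $\nabla F(x_t)+M+y$, with
  -- `M` the averaged drift and `y` the averaged noise.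
  have hrob : ∀ k, |(gg t ω - F' (x t ω) - y - M) k|
      ≤ (A₁ + A₂ * (1 + A₁)) * (Ξ + δ) := by
    intro k
    have h3 := (hr.aggregate t (by omega) htH ω).abs_nested_sub_mean_le hm hN h1 h1' h2 h2'
      (u := fun i τ => g (t - (τ : ℕ)) i ω) (hr.temporal t (by omega) htH hmt · ω) k
      (v := fun i τ => F' (x (t - τ) ω) k
        + batchNoise D f k (x (t - τ) ω) (fun j => z (t - τ) i j ω))
      (r := F' (x t ω) k) (Δ := Ξ + δ)
      (fun i => Finset.univ.filter fun τ : Fin m => W (t - τ) i ω = true)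
      (fun i τ hτ => by
        have hτ' : W (t - τ) i ω = false := by simpa using hτ
        rw [hr.trustworthy (t - τ) (by omega) (by omega) i ω hτ']
        exact gradient_empiricalRisk_coord hb hd _ _)
      (fun i τ => by
        have h4 : |F' (x (t - τ) ω) k - F' (x t ω) k| ≤ δ := by
          rw [← PiLp.sub_apply, ← Real.norm_eq_abs]
          exact (PiLp.norm_apply_le _ k).trans (hdrift τ)
        have h5 := abs_le.1 (hΞ i τ k)
        have h6 := abs_le.1 h4
        exact abs_le.2 ⟨by linarith, by linarith⟩)
      hgood
    refine le_of_eq_of_le ?_ h3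
    congr 1
    simp only [M, y, PiLp.sub_apply, PiLp.smul_apply, WithLp.ofLp_sum, Finset.sum_apply,
      smul_eq_mul, Finset.sum_sub_distrib, Finset.sum_add_distrib, mul_add, Finset.sum_const,
      Finset.card_univ, Fintype.card_fin, nsmul_eq_mul]
    field_simp
    ring
  have hnorm := norm_le_sqrt_mul _ hrob
  -- Each of $A_1\sqrt d$, $A_2\sqrt d$ costs a factor $3/2$; for the product, $\sqrt d\le\sqrt
  -- d\cdot\sqrt d$ yields $9/4$, which covers all terms.
  have hC : √(d : ℝ) * ((A₁ + A₂ * (1 + A₁)) * (Ξ + δ))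
      ≤ 9 / 4 * (Calpha d α₂ + Calpha d α₁ * (1 + Calpha d α₂)) * (Ξ + δ) := by
    have e1 := le_Calpha (d := d) h1 h1'
    have e2 := le_Calpha (d := d) h2 h2'
    have e3 : 1 ≤ √(d : ℝ) := by
      rw [Real.one_le_sqrt]; exact_mod_cast hdim
    have c1 := Calpha_nonneg (d := d) h1 h1'
    have c2 := Calpha_nonneg (d := d) h2 h2'
    change A₁ * √(d : ℝ) ≤ _ at e1
    change A₂ * √(d : ℝ) ≤ _ at e2
    have e4 : A₁ * A₂ * √(d : ℝ) ≤ 3 / 2 * Calpha d α₁ * (3 / 2 * Calpha d α₂) := by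
      calc A₁ * A₂ * √(d : ℝ) ≤ A₁ * A₂ * √(d : ℝ) * √(d : ℝ) :=
            le_mul_of_one_le_right (by positivity) e3
        _ = (A₁ * √(d : ℝ)) * (A₂ * √(d : ℝ)) := by ring
        _ ≤ _ := by gcongr
    rw [← mul_assoc]
    refine mul_le_mul_of_nonneg_right ?_ (by positivity)
    linarith
  have hsplit : gg t ω - F' (x t ω) = (gg t ω - F' (x t ω) - y - M) + y + M := by abel
  rw [hsplit]
  refine (norm_add₃_le).trans ?_
  linarith

/-- The decrease of the squared error in one iteration. -/
theorem IsRun.sq_norm_step_le (hr : IsRun ℱ f X x₁ γ α₁ α₂ m H W z g gh gg x)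
    (hX : Convex ℝ X) (hx₁ : x₁ ∈ X) (hγ : 0 ≤ γ)
    (hd : ∀ z, Differentiable ℝ fun y => f y z)
    (hlip : ∀ x ∈ X, ∀ y ∈ X,
      ‖gradient (risk D f) x - gradient (risk D f) y‖ ≤ L * ‖x - y‖)
    {μ : ℝ} (hμ : 0 < μ) (hμL : μ ≤ L) (hsc : IsStronglyConvexOn X μ (risk D f))
    {xstar : Vec d} (hxs : xstar ∈ X) (hopt : gradient (risk D f) xstar = 0)
    (hdim : 1 ≤ d) (hN : 1 ≤ N) (hm : 1 ≤ m) (hb : 1 ≤ b)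
    (h1 : 0 ≤ α₁) (h1' : α₁ < 1 / 2) (h2 : 0 ≤ α₂) (h2' : α₂ < 1 / 2)
    {t : ℕ} (hmt : m ≤ t) (htH : t ≤ H) {ω : Ω} {Ξ Q : ℝ}
    (hΞ : ∀ i (τ : Fin m) k, |batchNoise D f k (x (t - τ) ω) (fun j => z (t - τ) i j ω)| ≤ Ξ)
    (hQ : ‖(WithLp.toLp 2 fun k => (1 / (N : ℝ)) * ∑ i, (1 / (m : ℝ)) * ∑ τ : Fin m,
        batchNoise D f k (x (t - τ) ω) (fun j => z (t - τ) i j ω) : Vec d)‖ ≤ Q) :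
    ‖x (t + 1) ω - xstar‖ ^ 2 ≤ ‖x t ω - xstar‖ ^ 2 - 2 * γ * (μ / L) * ‖x t ω - xstar‖
      + 2 * γ * (1 + μ / L) * (‖x t ω - xstar‖ *
        (if α₂ * N < ((Finset.univ.filter fun i => α₁ * m <
          ((Finset.univ.filter fun τ : Fin m => W (t - τ) i ω = true).card : ℝ)).card : ℝ)
        then 1 else 0))
      + γ ^ 2
      + 4 * γ / μ * (9 / 4 * (Calpha d α₂ + Calpha d α₁ * (1 + Calpha d α₂))
        * (Ξ + L * (γ * (m - 1))) + Q + L * (γ * (m - 1))) := by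
  have hL : 0 < L := hμ.trans_le hμL
  have hm1 : (0 : ℝ) ≤ (m : ℝ) - 1 := by
    rw [sub_nonneg]; exact_mod_cast hm
  have hΞ0 : 0 ≤ Ξ := (abs_nonneg _).trans (hΞ ⟨0, hN⟩ ⟨0, hm⟩ ⟨0, hdim⟩)
  have hQ0 : 0 ≤ Q := (norm_nonneg _).trans hQ
  have c1 := Calpha_nonneg (d := d) h1 h1'
  have c2 := Calpha_nonneg (d := d) h2 h2'
  have hstep := (hr.update t (by omega) htH ω).sq_norm_step_le hX hxs
  have hmem : x t ω ∈ X := by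
    obtain ⟨u, rfl⟩ : ∃ u, t = u + 1 := ⟨t - 1, by omega⟩
    exact hr.iterate_mem hx₁ (by omega) ω
  -- On the failure event the two linear terms of the bound combine to $+2\gamma\|x_t-x^\star\|$,
  -- which is what Cauchy–Schwarz provides.
  split_ifs with hbad
  · have h3 := neg_norm_le_inner_normalized (gg t ω) (x t ω - xstar)
    have h4 : 0 ≤ 4 * γ / μ * (9 / 4 * (Calpha d α₂ + Calpha d α₁ * (1 + Calpha d α₂))
        * (Ξ + L * (γ * (m - 1))) + Q + L * (γ * (m - 1))) := by positivity
    have h5 := mul_le_mul_of_nonneg_left h3 hγ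
    linarith
  · have h3 := hr.norm_aggregate_sub_gradient_le hX hx₁ hγ hL.le hd hlip hdim hN hm hb h1 h1' h2
      h2' hmt htH hΞ hQ (not_lt.1 hbad)
    have h6 := hsc.2 _ hmem _ hxs
    have h7 := hlip _ hmem _ hxs
    rw [hopt, sub_zero] at h6 h7
    have h4 := inner_normalized_ge (v := gg t ω) hμ hμL h6 h7
    have h5 := mul_le_mul_of_nonneg_left h4 hγ
    have h8 := mul_le_mul_of_nonneg_left h3 (show 0 ≤ 4 * γ / μ by positivity)
    have e : 4 * γ / μ * ‖gg t ω - gradient (risk D f) (x t ω)‖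
        = 2 * (γ * (2 / μ * ‖gg t ω - gradient (risk D f) (x t ω)‖)) := by ring
    rw [e] at h8
    linarith

end Run

/-! ### The expected error -/

theorem geometric_recursion {u : ℕ → ℝ} {r B : ℝ} (hr : 0 ≤ r) {T : ℕ}
    (h : ∀ n < T, u (n + 1) ≤ r * u n + (1 - r) * B) (hB : 0 ≤ B) :
    u T ≤ r ^ T * u 0 + B := by
  suffices H : ∀ n ≤ T, u n ≤ r ^ n * u 0 + (1 - r ^ n) * B by
    have := H T le_rfl
    have h1 : 0 ≤ r ^ T * B := by positivity
    linarith
  intro n hn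
  induction n with
  | zero => simp
  | succ n ih =>
    have h1 := mul_le_mul_of_nonneg_left (ih (by omega)) hr
    have h2 := h n (by omega)
    rw [pow_succ]
    linarith

theorem le_of_stronglyConvex_of_lipschitz {d : ℕ} {X : Set (Vec d)} {h : Vec d → ℝ} {μ L : ℝ}
    (hsc : IsStronglyConvexOn X μ h)
    (hlip : ∀ x ∈ X, ∀ y ∈ X, ‖gradient h x - gradient h y‖ ≤ L * ‖x - y‖)
    {x y : Vec d} (hx : x ∈ X) (hy : y ∈ X) (hxy : x ≠ y) : μ ≤ L := by
  have h0 : 0 < ‖x - y‖ := norm_pos_iff.2 (sub_ne_zero.2 hxy)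
  have h1 := (hsc.2 x hx y hy).trans (real_inner_le_norm _ _)
  have h2 := mul_le_mul_of_nonneg_right (hlip x hx y hy) h0.le
  refine le_of_mul_le_mul_right (a := ‖x - y‖ ^ 2) ?_ (by positivity)
  linarith

/-- Matches the forward window of the Markov chain estimates with the backward window $t,t-1,\dots$
of the algorithm. -/
theorem sum_toNat_eq_card {m : ℕ} (w : ℕ → Bool) (s t : ℕ) (ht : t + 1 = s + m) :
    (∑ r ∈ Finset.range m, (w (s + r)).toNat)
      = (Finset.univ.filter fun τ : Fin m => w (t - τ) = true).card := by
  rw [Finset.card_filter, Fin.sum_univ_eq_sum_range (fun τ => if w (t - τ) = true then 1 else 0) m,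
    ← Finset.sum_range_reflect]
  refine Finset.sum_congr rfl fun r hr => ?_
  have := Finset.mem_range.1 hr
  have e : t - r = s + (m - 1 - r) := by omega
  rw [e]
  cases w (s + (m - 1 - r)) <;> rfl

section Run

variable {Ω Z : Type*} [mΩ : MeasurableSpace Ω] [MeasurableSpace Z] {P : Measure Ω}
  [IsProbabilityMeasure P] {ℱ : Filtration ℕ mΩ} {D : Measure Z} [IsProbabilityMeasure D]
  {d N b m m₀ H : ℕ} {f : Vec d → Z → ℝ} {X : Set (Vec d)} {x₁ xstar : Vec d}
  {γ α₁ α₂ pb pt σ a L μ p : ℝ} {W : ℕ → Fin N → Ω → Bool} {z : ℕ → Fin N → Fin b → Ω → Z}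
  {g gh : ℕ → Fin N → Ω → Vec d} {gg x : ℕ → Ω → Vec d}

/-- The pointwise decrease is integrated. Here `s` is the time at which the states are conditioned
upon, and the window occupies the iterations from `s + m₀` to `s + m₀ + m - 1`. -/
theorem IsEnvironment.integral_sq_norm_step_le (he : IsEnvironment P ℱ D pb pt H W z)
    (hr : IsRun ℱ f X x₁ γ α₁ α₂ m H W z g gh gg x)
    (hf : ∀ x, Measurable (f x)) (hd : ∀ z, Differentiable ℝ fun y => f y z)
    (hX : Convex ℝ X) (hXc : IsCompact X) (hx₁ : x₁ ∈ X) (hγ : 0 ≤ γ)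
    (hlip : ∀ x ∈ X, ∀ y ∈ X,
      ‖gradient (risk D f) x - gradient (risk D f) y‖ ≤ L * ‖x - y‖)
    (hμ : 0 < μ) (hμL : μ ≤ L) (hsc : IsStronglyConvexOn X μ (risk D f))
    (hxs : xstar ∈ X) (hopt : gradient (risk D f) xstar = 0)
    (ha : 0 ≤ a) (hσ : 0 < σ)
    (hsg : ∀ k : Fin d, ∀ x ∈ X, IsSubGamma D (sampleNoise D f k x) σ a)
    (hdim : 1 ≤ d) (hN : 1 ≤ N) (hm : 1 ≤ m) (hb : 1 ≤ b)
    (h1 : 0 ≤ α₁) (h1' : α₁ < 1 / 2) (h2 : 0 ≤ α₂) (h2' : α₂ < 1 / 2)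
    (hpb : 0 ≤ pb) (hpb' : pb ≤ 1) (hpt : 0 ≤ pt) (hpt' : pt ≤ 1)
    (hp : worstFailure pb pt α₁ α₂ N m m₀ ≤ p) (hpL : p < 1 / (1 + L / μ))
    (hR : 0 < Metric.diam X)
    {s : ℕ} (hs : 1 ≤ s) (hsH : s + m₀ + m ≤ H + 1) :
    ∫ ω, ‖x (s + m₀ + m) ω - xstar‖ ^ 2 ∂P
      ≤ (1 - czero (L / μ) (Metric.diam X) p * γ) * ∫ ω, ‖x (s + m₀ + m - 1) ω - xstar‖ ^ 2 ∂P
        + (9 / 4 * Cbar d (L / μ) p α₁ α₂ m m₀ * γ ^ 2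
        + 4 * γ / μ * (5 * (σ * √(d : ℝ) / √(m * N * b : ℝ))
          + 9 / 2 * (Calpha d α₂ + Calpha d α₁ * (1 + Calpha d α₂))
            * (σ * √(Real.log (4 * N * m * d)) / √(b : ℝ)
              + a * Real.log (4 * N * m * d) / b))) := by
  have hL : 0 < L := hμ.trans_le hμL
  have hm1 : (0 : ℝ) ≤ (m : ℝ) - 1 := by
    rw [sub_nonneg]; exact_mod_cast hm
  have c1 := Calpha_nonneg (d := d) h1 h1'
  have c2 := Calpha_nonneg (d := d) h2 h2'
  set R := Metric.diam X
  set Cc := Calpha d α₂ + Calpha d α₁ * (1 + Calpha d α₂)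
  have hCc : 0 ≤ Cc := by positivity
  obtain ⟨t, ht⟩ : ∃ t, s + m₀ + m = t + 1 := ⟨s + m₀ + m - 1, by omega⟩
  have ht' : s + m₀ + m - 1 = t := by omega
  rw [ht', ht]
  have hmt : m ≤ t := by omega
  have htH : t ≤ H := by omega
  let Δ : ℕ → Ω → ℝ := fun u ω => ‖x u ω - xstar‖
  have hΔm : ∀ u, 1 ≤ u → u ≤ H + 1 → Measurable[ℱ (u - 1)] (Δ u) := by
    intro u hu huH
    obtain ⟨v, rfl⟩ : ∃ v, u = v + 1 := ⟨u - 1, by omega⟩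
    have hn : Measurable fun y : Vec d => ‖y - xstar‖ := by fun_prop
    exact hn.comp (hr.measurable_iterate (by omega))
  have hΔm' : ∀ u, 1 ≤ u → u ≤ H + 1 → Measurable (Δ u) := fun u hu huH =>
    (hΔm u hu huH).mono (ℱ.le _) le_rfl
  have hΔ0 : ∀ u ω, 0 ≤ Δ u ω := fun u ω => norm_nonneg _
  have hΔR : ∀ u, 1 ≤ u → u ≤ H + 1 → ∀ ω, Δ u ω ≤ R := by
    intro u hu huH ω
    obtain ⟨v, rfl⟩ : ∃ v, u = v + 1 := ⟨u - 1, by omega⟩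
    have := Metric.dist_le_diam_of_mem hXc.isBounded
      (hr.iterate_mem hx₁ (t := v) (by omega) ω) hxs
    rwa [dist_eq_norm] at this
  have hΔi : ∀ u, 1 ≤ u → u ≤ H + 1 → Integrable (Δ u) P := fun u hu huH =>
    Integrable.of_bound (hΔm' u hu huH).aestronglyMeasurable R
      (Filter.Eventually.of_forall fun ω => by
        rw [Real.norm_of_nonneg (hΔ0 u ω)]; exact hΔR u hu huH ω)
  have hΔi2 : ∀ u, 1 ≤ u → u ≤ H + 1 → Integrable (fun ω => Δ u ω ^ 2) P := fun u hu huH =>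
    Integrable.of_bound ((hΔm' u hu huH).pow_const 2).aestronglyMeasurable (R ^ 2)
      (Filter.Eventually.of_forall fun ω => by
        rw [Real.norm_of_nonneg (sq_nonneg _)]
        exact pow_le_pow_left₀ (hΔ0 u ω) (hΔR u hu huH ω) 2)
  let I : Ω → ℝ := fun ω =>
    if α₂ * N < ((Finset.univ.filter fun i => α₁ * m <
      ((Finset.univ.filter fun τ : Fin m => W (t - τ) i ω = true).card : ℝ)).card : ℝ)
    then 1 else 0
  have hI0 : ∀ ω, 0 ≤ I ω := fun ω => by simp only [I]; split_ifs <;> simp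
  have hI1 : ∀ ω, I ω ≤ 1 := fun ω => by simp only [I]; split_ifs <;> simp
  have hIeq : I = fun ω => if α₂ * N < ((Finset.univ.filter fun i => α₁ * m <
        ((∑ r ∈ Finset.range m, (W (s + m₀ + r) i ω).toNat : ℕ) : ℝ)).card : ℝ)
        then 1 else 0 := by
    funext ω
    simp only [I]
    simp_rw [fun i => sum_toNat_eq_card (m := m) (fun u => W u i ω) (s + m₀) t (by omega)]
  have hIm : Measurable I := by
    let cnt : Ω → Fin N → ℕ := fun ω i => ∑ r ∈ Finset.range m, (W (s + m₀ + r) i ω).toNat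
    have hcnt : Measurable cnt := measurable_pi_iff.2 fun i =>
      Finset.measurable_sum _ fun r hr => (Measurable.of_discrete (f := Bool.toNat)).comp
        ((he.state_adapted (s + m₀ + r) (by omega)
          (by have := Finset.mem_range.1 hr; omega) i).mono (ℱ.le _) le_rfl)
    rw [hIeq]
    exact (Measurable.of_discrete (f := fun c : Fin N → ℕ => if α₂ * N <
      ((Finset.univ.filter fun i => α₁ * m < ((c i : ℕ) : ℝ)).card : ℝ) then (1 : ℝ) else 0)).comp
      hcnt
  have hΔIi : Integrable (fun ω => Δ t ω * I ω) P :=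
    Integrable.of_bound ((hΔm' t (by omega) (by omega)).mul hIm).aestronglyMeasurable R
      (Filter.Eventually.of_forall fun ω => by
        rw [Real.norm_of_nonneg (mul_nonneg (hΔ0 t ω) (hI0 ω))]
        exact (mul_le_of_le_one_right (hΔ0 t ω) (hI1 ω)).trans (hΔR t (by omega) (by omega) ω))
  -- the contribution of the failure event
  set q : ℝ := (m : ℝ) - 1 + m₀
  have hq : 0 ≤ q := by positivity
  have hts : t = s + (m - 1 + m₀) := by omega
  have hmove : ∀ ω, ‖x t ω - x s ω‖ ≤ γ * q := by
    intro ω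
    have h3 := hr.norm_iterate_sub_le hX hx₁ hγ hs (m - 1 + m₀) (by omega) ω
    rw [← hts] at h3
    refine h3.trans (le_of_eq ?_)
    push_cast [Nat.cast_sub hm]
    rfl
  have hts1 : ∀ ω, Δ t ω ≤ Δ s ω + γ * q := by
    intro ω
    have := norm_sub_le_norm_sub_add_norm_sub (x t ω) (x s ω) xstar
    linarith [hmove ω]
  have hts2 : ∀ ω, Δ s ω ≤ Δ t ω + γ * q := by
    intro ω
    have := norm_sub_le_norm_sub_add_norm_sub (x s ω) (x t ω) xstar
    rw [norm_sub_rev (x s ω) (x t ω)] at this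
    linarith [hmove ω]
  have hp0 : 0 ≤ p := by
    have h3 : ∫ ω, 1 * I ω ∂P ≤ p * ∫ _ω, 1 ∂P := by
      rw [hIeq]
      exact he.integral_mul_failure_le hpb hpb' hpt hpt' hs hm hsH hp (Y := fun _ => 1)
        measurable_const (fun _ => zero_le_one) (fun _ => le_rfl)
    simp only [one_mul, integral_const, probReal_univ, smul_eq_mul, mul_one] at h3
    exact (integral_nonneg hI0).trans h3
  -- The distance at time `t` is not known at time `s`. Passing to `Δ s` to apply the conditional
  -- bound, and back to `Δ t` afterwards, costs `γ * q` each time.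
  have hfail : ∫ ω, Δ t ω * I ω ∂P ≤ p * (∫ ω, Δ t ω ∂P + 2 * (γ * q)) := by
    have h3 : ∫ ω, (Δ s ω + γ * q) * I ω ∂P ≤ p * ∫ ω, (Δ s ω + γ * q) ∂P := by
      rw [hIeq]
      exact he.integral_mul_failure_le hpb hpb' hpt hpt' hs hm hsH hp
        (Y := fun ω => Δ s ω + γ * q)
        (((hΔm s hs (by omega)).mono (ℱ.mono (Nat.sub_le s 1)) le_rfl).add_const _)
        (fun ω => add_nonneg (hΔ0 s ω) (by positivity))
        (fun ω => add_le_add_left (hΔR s hs (by omega) ω) _)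
    have h4 : ∫ ω, Δ t ω * I ω ∂P ≤ ∫ ω, (Δ s ω + γ * q) * I ω ∂P := by
      refine integral_mono hΔIi ?_ fun ω => mul_le_mul_of_nonneg_right (hts1 ω) (hI0 ω)
      refine Integrable.of_bound (((hΔm' s hs (by omega)).add_const _).mul hIm).aestronglyMeasurable
        (R + γ * q) (Filter.Eventually.of_forall fun ω => ?_)
      have h5 : 0 ≤ Δ s ω + γ * q := add_nonneg (hΔ0 s ω) (by positivity)
      rw [Real.norm_of_nonneg (mul_nonneg h5 (hI0 ω))]
      exact (mul_le_of_le_one_right h5 (hI1 ω)).trans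
        (add_le_add_left (hΔR s hs (by omega) ω) _)
    have h5 : ∫ ω, (Δ s ω + γ * q) ∂P ≤ ∫ ω, Δ t ω ∂P + 2 * (γ * q) := by
      have h6 : ∫ ω, (Δ s ω + γ * q) ∂P ≤ ∫ ω, (Δ t ω + 2 * (γ * q)) ∂P :=
        integral_mono ((hΔi s hs (by omega)).add (integrable_const _))
          ((hΔi t (by omega) (by omega)).add (integrable_const _)) fun ω => by
            have := hts2 ω
            dsimp only
            linarith
      rwa [integral_add (hΔi t (by omega) (by omega)) (integrable_const (2 * (γ * q))),
        integral_const (2 * (γ * q)), probReal_univ, one_smul] at h6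
    exact h4.trans (h3.trans (mul_le_mul_of_nonneg_left h5 hp0))
  -- the contribution of the noise
  obtain ⟨Ξ, hΞi, hΞ, hΞE⟩ := exists_maxNoise_envelope he hr hf hd hx₁ hb ha hσ hsg hN hm hdim
    hmt htH
  obtain ⟨Q, hQi, hQ, hQE⟩ := exists_meanNoise_envelope he hr hf hd hx₁ hb ha hσ hsg hN hm hdim
    hmt htH
  set V := σ * √(d : ℝ) / √(m * N * b : ℝ)
  set Λ := σ * √(Real.log (4 * N * m * d)) / √(b : ℝ) + a * Real.log (4 * N * m * d) / b
  set δ := L * (γ * ((m : ℝ) - 1))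
  have hEi : Integrable (fun ω => 9 / 4 * Cc * (Ξ ω + δ) + Q ω + δ) P :=
    ((((hΞi.add (integrable_const δ)).const_mul (9 / 4 * Cc)).add hQi).add (integrable_const δ))
  have hE : ∫ ω, (9 / 4 * Cc * (Ξ ω + δ) + Q ω + δ) ∂P
      ≤ 9 / 4 * Cc * (2 * Λ + δ) + 5 * V + δ := by
    have i1 : Integrable (fun ω => 9 / 4 * Cc * (Ξ ω + δ)) P :=
      (hΞi.add (integrable_const δ)).const_mul (9 / 4 * Cc)
    have i2 : Integrable (fun ω => 9 / 4 * Cc * (Ξ ω + δ) + Q ω) P := i1.add hQi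
    rw [integral_add i2 (integrable_const δ), integral_add i1 hQi, integral_const_mul,
      integral_add hΞi (integrable_const δ), integral_const, probReal_univ, one_smul]
    gcongr
  -- integration of the pointwise inequality
  have hint : ∫ ω, Δ (t + 1) ω ^ 2 ∂P
      ≤ ∫ ω, Δ t ω ^ 2 ∂P - 2 * γ * (μ / L) * ∫ ω, Δ t ω ∂P
        + 2 * γ * (1 + μ / L) * ∫ ω, Δ t ω * I ω ∂P + γ ^ 2
        + 4 * γ / μ * ∫ ω, (9 / 4 * Cc * (Ξ ω + δ) + Q ω + δ) ∂P := by
    have i0 := hΔi2 t (by omega) (by omega)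
    have i1 := (hΔi t (by omega) (by omega)).const_mul (2 * γ * (μ / L))
    have i2 := hΔIi.const_mul (2 * γ * (1 + μ / L))
    have i3 := hEi.const_mul (4 * γ / μ)
    have i01 : Integrable (fun ω => Δ t ω ^ 2 - 2 * γ * (μ / L) * Δ t ω) P := i0.sub i1
    have i02 : Integrable (fun ω => Δ t ω ^ 2 - 2 * γ * (μ / L) * Δ t ω
      + 2 * γ * (1 + μ / L) * (Δ t ω * I ω)) P := i01.add i2
    have i03 : Integrable (fun ω => Δ t ω ^ 2 - 2 * γ * (μ / L) * Δ t ω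
      + 2 * γ * (1 + μ / L) * (Δ t ω * I ω) + γ ^ 2) P := i02.add (integrable_const _)
    have h3 := integral_mono (hΔi2 (t + 1) (by omega) (by omega)) (i03.add i3) fun ω =>
      hr.sq_norm_step_le hX hx₁ hγ hd hlip hμ hμL hsc hxs hopt hdim hN hm hb h1 h1' h2 h2' hmt htH
        (hΞ ω) (hQ ω)
    refine h3.trans (le_of_eq ?_)
    rw [integral_add' i03 i3, integral_add i02 (integrable_const _), integral_add i01 i2,
      integral_sub i0 i1, integral_const_mul, integral_const_mul, integral_const_mul,
      integral_const, probReal_univ, one_smul]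
  -- Normalized steps give a decrease linear in the distance; bounding one factor by the diameter
  -- converts it into a contraction of the square, at the rate `czero`.
  have hsqR : ∫ ω, Δ t ω ^ 2 ∂P ≤ R * ∫ ω, Δ t ω ∂P := by
    rw [← integral_const_mul]
    refine integral_mono (hΔi2 t (by omega) (by omega))
      ((hΔi t (by omega) (by omega)).const_mul R) fun ω => ?_
    dsimp only
    rw [sq]
    exact mul_le_mul_of_nonneg_right (hΔR t (by omega) (by omega) ω) (hΔ0 t ω)
  set A := ∫ ω, Δ t ω ^ 2 ∂P
  set B := ∫ ω, Δ t ω ∂P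
  have hc0 : 0 ≤ czero (L / μ) R p := by
    rw [lt_div_iff₀ (by positivity)] at hpL
    unfold czero
    exact mul_nonneg (by positivity) (by linarith)
  have hcR : czero (L / μ) R p * R = 2 * (μ / L - p * (1 + μ / L)) := by
    unfold czero
    field_simp
    ring
  have hcA : czero (L / μ) R p * γ * A ≤ 2 * γ * (μ / L - p * (1 + μ / L)) * B := by
    calc _ ≤ czero (L / μ) R p * γ * (R * B) := by gcongr
      _ = (czero (L / μ) R p * R) * γ * B := by ring
      _ = _ := by rw [hcR]; ring
  have hfail' := mul_le_mul_of_nonneg_left hfail (show 0 ≤ 2 * γ * (1 + μ / L) by positivity)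
  have hE' := mul_le_mul_of_nonneg_left hE (show 0 ≤ 4 * γ / μ by positivity)
  -- All terms of order $\gamma^2$: displacement during conditioning, the squared step, and gradient
  -- drift over the window.
  have hCbar : 4 * p * (1 + μ / L) * q * γ ^ 2 + γ ^ 2 + 4 * γ / μ * (9 / 4 * Cc * δ + δ)
      ≤ 9 / 4 * Cbar d (L / μ) p α₁ α₂ m m₀ * γ ^ 2 := by
    have e1 : 4 * γ / μ * (9 / 4 * Cc * δ + δ)
        = 4 * (L / μ) * ((m : ℝ) - 1) * (9 / 4 * Cc + 1) * γ ^ 2 := by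
      simp only [δ]; ring
    have e2 : 1 / (L / μ) = μ / L := one_div_div _ _
    rw [e1]
    unfold Cbar
    rw [e2]
    have e3 : 4 * (L / μ) * ((m : ℝ) - 1) * (9 / 4 * Cc + 1)
        ≤ 9 / 4 * (4 * (L / μ) * ((m : ℝ) - 1)
          * (1 + Calpha d α₁ + 2 * Calpha d α₂ * (Calpha d α₁ + 1))) := by
      have e4 : 9 / 4 * Cc + 1
          ≤ 9 / 4 * (1 + Calpha d α₁ + 2 * Calpha d α₂ * (Calpha d α₁ + 1)) := by
        have : 0 ≤ Calpha d α₁ * Calpha d α₂ := by positivity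
        simp only [Cc]
        linarith
      have := mul_le_mul_of_nonneg_left e4 (show 0 ≤ 4 * (L / μ) * ((m : ℝ) - 1) by positivity)
      linarith
    have e5 : 0 ≤ 4 * p * (1 + μ / L) * q := by positivity
    have e6 : 4 * p * (1 + μ / L) * q + 1 + 4 * (L / μ) * ((m : ℝ) - 1) * (9 / 4 * Cc + 1)
        ≤ 9 / 4 * (1 + 4 * p * (1 + μ / L) * q + 4 * (L / μ) * ((m : ℝ) - 1)
          * (1 + Calpha d α₁ + 2 * Calpha d α₂ * (Calpha d α₁ + 1))) := by
      linarith
    have := mul_le_mul_of_nonneg_right e6 (sq_nonneg γ)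
    linarith
  change ∫ ω, Δ (t + 1) ω ^ 2 ∂P ≤ _
  linarith

end Run

/-- The step-size condition gives $\gamma\,Cb\le8V'/\mu$, so the quadratic term costs
$\frac94\cdot8=18$ units of $\gamma V'/\mu$. The averaged noise adds $4\cdot5=20$, whence 38; the
coefficient of `Y` is only $4\cdot\frac92=18$. -/
theorem step_error_le {γ μ σ S S' V V' Cb Y c₀ K : ℝ} {d : ℕ} (hγ : 0 < γ) (hμ : 0 < μ)
    (hσ : 0 < σ) (hd : 1 ≤ d) (hS' : 0 < S') (hSS' : S' ≤ 2 * S) (hc : 0 < c₀)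
    (hγle : γ ≤ 4 * σ / (Cb * μ * S)) (hV : V ≤ V') (hV' : V' = σ * √(d : ℝ) / S')
    (hY : 0 ≤ Y) (hK : K = 38) :
    9 / 4 * Cb * γ ^ 2 + 4 * γ / μ * (5 * V + 9 / 2 * Y)
      ≤ c₀ * γ * (K / (μ * c₀) * (V' + Y)) := by
  have hSpos : 0 < S := by linarith
  have hpos : 0 < 4 * σ / (Cb * μ * S) := hγ.trans_le hγle
  -- A positive step below the bound forces a positive denominator, so positivity of `Cb` need not
  -- be assumed.
  have hden : 0 < Cb * μ * S := by
    by_contra! hcon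
    exact absurd hpos (not_lt.2 (div_nonpos_of_nonneg_of_nonpos (by positivity) hcon))
  have hCb : 0 < Cb := by
    by_contra! hcon
    nlinarith [mul_pos hμ hSpos]
  rw [le_div_iff₀ hden] at hγle
  have h1 : 1 ≤ √(d : ℝ) := by
    rw [Real.one_le_sqrt]; exact_mod_cast hd
  have h2 : γ * Cb ≤ 8 * V' / μ := by
    rw [le_div_iff₀ hμ, hV', ← mul_div_assoc, le_div_iff₀ hS']
    have h3 : γ * Cb * μ * S' ≤ γ * Cb * μ * (2 * S) := by gcongr
    have h4 : σ * 1 ≤ σ * √(d : ℝ) := by gcongr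
    linarith
  have h5 : c₀ * γ * (K / (μ * c₀) * (V' + Y)) = γ / μ * (38 * (V' + Y)) := by
    rw [hK]; field_simp
  have h6 : 9 / 4 * Cb * γ ^ 2 ≤ γ / μ * (18 * V') := by
    have := mul_le_mul_of_nonneg_left h2 hγ.le
    have e : γ / μ * (18 * V') = 9 / 4 * (γ * (8 * V' / μ)) := by ring
    rw [e]
    linarith
  have h7 : 4 * γ / μ * (5 * V + 9 / 2 * Y) ≤ γ / μ * (20 * V' + 18 * Y) := by
    have e : 4 * γ / μ * (5 * V + 9 / 2 * Y) = γ / μ * (20 * V + 18 * Y) := by ring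
    rw [e]
    gcongr
  have h8 : 0 ≤ γ / μ * Y := by positivity
  rw [h5]
  linarith

end RANGE

end

/-! ### Assembly of the error bound -/

theorem theorem3 :
    -- one absolute constant for all problems, networks and algorithm parameters
    ∃ K : ℝ, 0 < K ∧
    ∀ (Ω : Type*) (Z : Type*) [mΩ : MeasurableSpace Ω] [MeasurableSpace Z]
      (P : Measure Ω) [IsProbabilityMeasure P] (D : Measure Z) [IsProbabilityMeasure D]
      (d N b m m₀ T : ℕ) (_ : 1 ≤ N) (_ : 1 ≤ b) (_ : 1 ≤ m) (_ : 1 ≤ T)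
      -- the optimization problem
      (f : RANGE.Vec d → Z → ℝ) (X : Set (RANGE.Vec d)) (xstar x₁ : RANGE.Vec d)
      (L μ σ a : ℝ) (_ : 0 < L) (_ : 0 < μ) (_ : 0 ≤ σ) (_ : 0 ≤ a)
      (_ : ∀ x, Measurable (f x)) (_ : ∀ x, Integrable (f x) D)
      (_ : RANGE.IsStronglyConvexOn X μ (RANGE.risk D f))
      (_ : ∀ k : Fin d, ∀ x ∈ X, RANGE.IsSubGamma D
        (fun z => gradient (fun y => f y z) x k - gradient (RANGE.risk D f) x k) σ a)
      (_ : ∀ z, RANGE.IsSmoothOn X L (fun y => f y z))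
      (_ : Convex ℝ X) (_ : IsCompact X)
      (_ : xstar ∈ X) (_ : ∀ y ∈ X, RANGE.risk D f xstar ≤ RANGE.risk D f y)
      (_ : ∀ y ∈ X, RANGE.risk D f y ≤ RANGE.risk D f xstar → y = xstar)
      (_ : gradient (RANGE.risk D f) xstar = 0)
      (_ : x₁ ∈ X)
      -- the network and the parameters of the algorithm
      (pb pt α₁ α₂ γ p : ℝ) (_ : 0 < pb) (_ : pb < pt) (_ : pt < 1)
      (_ : 0 ≤ α₁) (_ : α₁ < 1 / 2) (_ : ∃ n : ℕ, α₁ * m = n)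
      (_ : 0 ≤ α₂) (_ : α₂ < 1 / 2) (_ : ∃ n : ℕ, α₂ * N = n)
      -- `p` is a uniform bound on the failure probability
      (_ : RANGE.worstFailure pb pt α₁ α₂ N m m₀ ≤ p)
      (_ : p < 1 / (1 + L / μ))
      (_ : 0 < γ)
      (_ : γ ≤ 4 * σ / (RANGE.Cbar d (L / μ) p α₁ α₂ m m₀ * μ
        * √((1 - α₂) * N * ((1 - α₁) * m) * b)))
      (_ : RANGE.czero (L / μ) (Metric.diam X) p * γ ≤ 1)
      -- the randomness and the run
      (ℱ : Filtration ℕ mΩ)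
      (W : ℕ → Fin N → Ω → Bool) (z : ℕ → Fin N → Fin b → Ω → Z)
      (g gh : ℕ → Fin N → Ω → RANGE.Vec d) (gg x : ℕ → Ω → RANGE.Vec d)
      (_ : RANGE.IsEnvironment P ℱ D pb pt (T + m - 1 + m₀) W z)
      (_ : RANGE.IsRun ℱ f X x₁ γ α₁ α₂ m (T + m - 1 + m₀) W z g gh gg x),
      ∫ ω, ‖x (T + m + m₀) ω - xstar‖ ^ 2 ∂P ≤
        (‖x₁ - xstar‖ + γ * ((m : ℝ) + m₀ - 1)) ^ 2
            * (1 - RANGE.czero (L / μ) (Metric.diam X) p * γ) ^ T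
          + K / (μ * RANGE.czero (L / μ) (Metric.diam X) p)
            * (σ * √(d : ℝ) / √((1 - α₁) * m * N * b)
              + (RANGE.Calpha d α₂ + RANGE.Calpha d α₁ * (1 + RANGE.Calpha d α₂))
                * (σ * √(Real.log (4 * N * m * d)) / √(b : ℝ)
                  + a * Real.log (4 * N * m * d) / b)) := by
  refine ⟨38, by norm_num, ?_⟩
  intro Ω Z mΩ _ P _ D _ d N b m m₀ T hN hb hm hT f X xstar x₁ L μ σ a hL hμ hσ0 ha hf _ hsc hsg
    hsm hX hXc hxs _ _ hopt hx₁ pb pt α₁ α₂ γ p hpb hpbt hpt hα₁ hα₁' _ hα₂ hα₂' _ hp hpL hγ hγle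
    hcγ ℱ W z g gh gg x he hr
  have hmem : ∀ t ≤ T + m - 1 + m₀, ∀ ω, x (t + 1) ω ∈ X := fun t ht ω => hr.iterate_mem hx₁ ht ω
  -- For diameter zero, division by zero makes `czero` and the error term vanish, but the left side
  -- is zero as well.
  rcases (Metric.diam_nonneg (s := X)).eq_or_lt with hR | hR
  · have hzero : ∀ ω, ‖x (T + m + m₀) ω - xstar‖ ^ 2 = 0 := by
      intro ω
      have h1 := Metric.dist_le_diam_of_mem hXc.isBounded
        (hmem (T + m - 1 + m₀) le_rfl ω) hxs
      rw [← hR, show T + m - 1 + m₀ + 1 = T + m + m₀ by omega, dist_eq_norm] at h1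
      rw [le_antisymm h1 (norm_nonneg _)]
      norm_num
    simp only [hzero, integral_zero, ← hR, RANGE.czero, mul_zero, div_zero, zero_mul, sub_zero,
      one_pow, mul_one, add_zero]
    positivity
  have hsg' : ∀ k : Fin d, ∀ x ∈ X, RANGE.IsSubGamma D (RANGE.sampleNoise D f k x) σ a := hsg
  have hd : ∀ z, Differentiable ℝ fun y => f y z := fun z => (hsm z).1
  have hlip : ∀ x ∈ X, ∀ y ∈ X, ‖gradient (RANGE.risk D f) x - gradient (RANGE.risk D f) y‖
      ≤ L * ‖x - y‖ := fun x hx y hy =>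
    RANGE.norm_gradient_risk_sub_le ha hf hsg hsm hx hy
  obtain ⟨y₁, hy₁, y₂, hy₂, hy⟩ : X.Nontrivial := by
    by_contra hcon
    rw [Set.not_nontrivial_iff] at hcon
    exact hR.ne' (Metric.diam_subsingleton hcon)
  have hμL : μ ≤ L := RANGE.le_of_stronglyConvex_of_lipschitz hsc hlip hy₁ hy₂ hy
  have hdim : 1 ≤ d := by
    by_contra! hcon
    obtain rfl : d = 0 := by omega
    exact hy (Subsingleton.elim _ _)
  -- If $\sigma=0$, the step-size condition would force $\gamma\le0$.
  have hσ : 0 < σ := by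
    rcases hσ0.eq_or_lt with h | h
    · rw [← h, mul_zero, zero_div] at hγle
      exact absurd hγ (not_lt.2 hγle)
    · exact h
  have hN0 : (0 : ℝ) < N := by exact_mod_cast hN
  have hm0 : (0 : ℝ) < m := by exact_mod_cast hm
  have hb0 : (0 : ℝ) < b := by exact_mod_cast hb
  have hα₁0 : 0 < 1 - α₁ := by linarith
  have hα₂0 : 0 < 1 - α₂ := by linarith
  have hm1 : (0 : ℝ) ≤ (m : ℝ) - 1 := by
    rw [sub_nonneg]; exact_mod_cast hm
  have c1 := RANGE.Calpha_nonneg (d := d) hα₁ hα₁'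
  have c2 := RANGE.Calpha_nonneg (d := d) hα₂ hα₂'
  set c₀ := RANGE.czero (L / μ) (Metric.diam X) p
  have hc₀ : 0 < c₀ := by
    rw [lt_div_iff₀ (by positivity)] at hpL
    exact mul_pos (by positivity) (by linarith)
  set Λ := σ * √(Real.log (4 * N * m * d)) / √(b : ℝ) + a * Real.log (4 * N * m * d) / b
  have hlog : 0 ≤ Real.log (4 * N * m * d) := by
    apply Real.log_nonneg
    have : (1 : ℝ) ≤ 4 * N * m * d := by
      exact_mod_cast Nat.mul_pos (Nat.mul_pos (Nat.mul_pos four_pos hN) hm) hdim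
    exact this
  have hΛ : 0 ≤ Λ := by positivity
  set Cc := RANGE.Calpha d α₂ + RANGE.Calpha d α₁ * (1 + RANGE.Calpha d α₂)
  have hCc : 0 ≤ Cc := by positivity
  -- The conditioning time is `n + 1`, at least 1, so the recursion starts from the iterate `m₀ +
  -- m`, which is `m₀ + m - 1` steps away from `x₁`.
  have hstep : ∀ n < T, ∫ ω, ‖x (n + 1 + m₀ + m) ω - xstar‖ ^ 2 ∂P
      ≤ (1 - c₀ * γ) * ∫ ω, ‖x (n + m₀ + m) ω - xstar‖ ^ 2 ∂P
        + (1 - (1 - c₀ * γ)) * (38 / (μ * c₀)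
          * (σ * √(d : ℝ) / √((1 - α₁) * m * N * b) + Cc * Λ)) := by
    intro n hn
    have h := he.integral_sq_norm_step_le (m₀ := m₀) (p := p) hr hf hd hX hXc hx₁ hγ.le hlip hμ
      hμL hsc hxs hopt ha hσ hsg' hdim hN hm hb hα₁ hα₁' hα₂ hα₂' hpb.le (by linarith)
      (by linarith) hpt.le hp hpL hR (s := n + 1) (by omega) (by omega)
    rw [show n + 1 + m₀ + m - 1 = n + m₀ + m by omega] at h
    refine h.trans (add_le_add_right ?_ _)
    rw [sub_sub_cancel, mul_assoc (9 / 2 : ℝ)]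
    refine RANGE.step_error_le hγ hμ hσ hdim (S' := √((1 - α₁) * m * N * b)) (by positivity) ?_
      hc₀ hγle ?_ rfl (by positivity) rfl
    -- The factor $1-\alpha_2>1/2$ under the root of the step-size condition is lost here:
    -- $4(1-\alpha_2)\ge1$.
    · have h4 : (2 : ℝ) = √4 := by
        rw [show (4 : ℝ) = 2 ^ 2 by norm_num, Real.sqrt_sq (by norm_num)]
      rw [h4, ← Real.sqrt_mul (by norm_num)]
      apply Real.sqrt_le_sqrt
      have h5 : 0 < (1 - α₁) * m * N * b := by positivity
      have h6 := mul_le_mul_of_nonneg_right (show 1 ≤ 4 * (1 - α₂) by linarith) h5.le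
      linarith
    · refine div_le_div_of_nonneg_left (by positivity) (by positivity) (Real.sqrt_le_sqrt ?_)
      have h5 : (0 : ℝ) < m * N * b := by positivity
      have h6 := mul_le_mul_of_nonneg_right (show 1 - α₁ ≤ 1 by linarith) h5.le
      linarith
  have hrec := RANGE.geometric_recursion
    (u := fun n => ∫ ω, ‖x (n + m₀ + m) ω - xstar‖ ^ 2 ∂P) (sub_nonneg.2 hcγ) hstep
    (by positivity)
  rw [show T + m₀ + m = T + m + m₀ by omega, mul_comm ((1 - c₀ * γ) ^ T)] at hrec
  refine hrec.trans (add_le_add_left (mul_le_mul_of_nonneg_right ?_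
    (pow_nonneg (sub_nonneg.2 hcγ) T)) _)
  have hinit : ∀ ω, ‖x (0 + m₀ + m) ω - xstar‖ ^ 2
      ≤ (‖x₁ - xstar‖ + γ * ((m : ℝ) + m₀ - 1)) ^ 2 := by
    intro ω
    have h1 := hr.norm_iterate_sub_le hX hx₁ hγ.le le_rfl (m₀ + m - 1) (by omega) ω
    rw [show 1 + (m₀ + m - 1) = 0 + m₀ + m by omega, hr.init ω] at h1
    have h2 := norm_sub_le_norm_sub_add_norm_sub (x (0 + m₀ + m) ω) x₁ xstar
    have h3 : ((m₀ + m - 1 : ℕ) : ℝ) = (m : ℝ) + m₀ - 1 := by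
      rw [Nat.cast_sub (by omega)]
      push_cast
      ring
    rw [h3] at h1
    exact pow_le_pow_left₀ (norm_nonneg _) (by linarith) 2
  calc _ ≤ ∫ _ω, (‖x₁ - xstar‖ + γ * ((m : ℝ) + m₀ - 1)) ^ 2 ∂P := by
        refine integral_mono_of_nonneg (Filter.Eventually.of_forall fun ω => sq_nonneg _)
          (integrable_const _) (Filter.Eventually.of_forall hinit)
    _ = _ := by simp
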